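/- Let $\omega=e^{2\pi i/3}$, let $q_i=\omega^i$ $(i=0,1,2)$, let $F_i(z)=\tfrac12(z-q_i)+q_i$, and let $SG\subset\mathbb C$ be the standard Sierpinski gasket with vertices $q_0,q_1,q_2$, i.e. $SG=\bigcup_{i=0}^2F_i(SG)$. Write $\omega$ also for the rotation $z\mapsto\omega z$ of $SG$ and $\mathfrak c$ for the reflection $z\mapsto\bar z$ of $SG$. Let $\tilde F_0=F_0$, $\tilde F_1=F_1\circ\omega^2$, $\tilde F_2=F_2\circ\omega$, and let $R:SG\to SG$ be the continuous map with $R\circ\tilde F_i=\mathrm{id}$ for $i=0,1,2$. Under any homeomorphism of $SG$ onto the Julia set of the rational map $z\mapsto z^2-\tfrac{16}{27z}$ that commutes with the rotation $\omega$ and with complex conjugation and carries $F_0$ to an inverse branch of the rational map, all the $\tilde F_i$ are carried to inverse branches of the rational map and $R$ to the rational map itself. A nondegenerate energy form on $SG$ is a quadratic form $\mathcal E:C(SG)\to[0,\infty]$, with domain $\mathrm{dom}\,\mathcal E=\{u\in C(SG):\mathcal E(u)<\infty\}$, such that: $\mathcal E(u)=0$ if and only if $u$ is constant; $\mathrm{dom}\,\mathcal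 E$ separates points; for all $x,y$ there is $C$ with $|u(x)-u(y)|^2\le C\,\mathcal E(u)$ on $\mathrm{dom}\,\mathcal E$; $\mathrm{dom}\,\mathcal E$ modulo constants is complete; and $\mathcal E(\max(0,\min(1,u)))\le\mathcal E(u)$. It is self-similar with weights $s_0,s_1,s_2>0$ if $$\mathcal E(u)=\sum_{i=0}^2s_i^{-1}\mathcal E(u\circ\tilde F_i)\quad\text{for all }u\in C(SG)$$ (in particular, $u\in\mathrm{dom}\,\mathcal E$ if and only if $u\circ\tilde F_i\in\mathrm{dom}\,\mathcal E$ for all $i$). Theorem. For any positive weights $(r_0,r_1,r_2)$ with $r_1=r_2$ there is a unique $\lambda>0$ such that a nondegenerate energy form exists that is self-similar with the weights $\tilde r_i=\lambda^{-1}r_i$. For this $\lambda$ the form is unique up to a positive constant multiple, and $0<\tilde r_i<1$ for $i=0,1,2$. Moreover, these forms are symmetric and $R$-invariant: $$\mathcal E(u\circ\mathfrak c)=\mathcal E(u)\quad\text{and}\quad\mathcal E(u\circ R)=\Big(\sum_{i=0}^2\tilde r_i^{-1}\Big)\mathcal E(u),$$ and, among the nondegenerate energy forms that are self-similar with some positive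 weights $(s_0,s_1,s_2)$, they are all the forms that are symmetric and $R$-invariant in this sense (with $s_i$ in place of $\tilde r_i$). -/

import Mathlib

open scoped ENNReal Topology

/-! ### The Sierpinski gasket and its maps -/

/-- The primitive third root of unity `e^{2πi/3}`. -/
noncomputable def omega : ℂ := Complex.exp (2 * Real.pi * Complex.I / 3)

/-- The vertices `q₀ = 1`, `q₁ = ω`, `q₂ = ω²` of an equilateral triangle centred at `0`. -/
noncomputable def vertex (i : Fin 3) : ℂ := omega ^ (i : ℕ)

/-- The planar contraction `z ↦ (z - qᵢ)/2 + qᵢ`. -/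
noncomputable def contraction (i : Fin 3) (z : ℂ) : ℂ := (1 / 2) * (z - vertex i) + vertex i

/-- The `n`-th stage of the construction of the gasket: start with the closed triangle, and
replace the set by the union of its three half-size copies (that is, remove the middle). -/
noncomputable def prefractal : ℕ → Set ℂ
  | 0 => convexHull ℝ (Set.range vertex)
  | n + 1 => ⋃ i, contraction i '' prefractal n

/-- The standard Sierpinski gasket `SG`. -/
def gasket : Set ℂ := ⋂ n, prefractal n

theorem omega_eq : omega = ⟨-1 / 2, √3 / 2⟩ := by
  have h : (2 * Real.pi * Complex.I / 3 : ℂ) = ((Real.pi - Real.pi / 3 : ℝ) : ℂ) * Complex.I := by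
    push_cast; ring
  rw [omega, h, Complex.exp_mul_I, ← Complex.ofReal_cos, ← Complex.ofReal_sin,
    Real.cos_pi_sub, Real.sin_pi_sub, Real.cos_pi_div_three, Real.sin_pi_div_three]
  apply Complex.ext <;> simp
  norm_num

theorem omega_pow_three : omega ^ 3 = 1 := by
  rw [omega, ← Complex.exp_nat_mul]
  rw [show ((3 : ℕ) : ℂ) * (2 * Real.pi * Complex.I / 3) = 2 * Real.pi * Complex.I by
    push_cast; ring]
  exact Complex.exp_two_pi_mul_I

theorem omega_mul_vertex (i : Fin 3) : omega * vertex i = vertex (i + 1) := by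
  have h := omega_pow_three
  fin_cases i
  · simp [vertex]
  · change omega * omega ^ 1 = omega ^ 2
    ring
  · change omega * omega ^ 2 = omega ^ 0
    linear_combination h

theorem conj_omega : (starRingEnd ℂ) omega = omega ^ 2 := by
  have h3 : √3 * √3 = 3 := Real.mul_self_sqrt (by norm_num)
  rw [omega_eq]
  apply Complex.ext <;> simp [pow_two] <;> linarith

theorem conj_vertex (i : Fin 3) : (starRingEnd ℂ) (vertex i) = vertex (-i) := by
  have h := omega_pow_three
  fin_cases i
  · simp [vertex]
  · change (starRingEnd ℂ) (omega ^ 1) = omega ^ 2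
    rw [pow_one, conj_omega]
  · change (starRingEnd ℂ) (omega ^ 2) = omega ^ 1
    rw [map_pow, conj_omega]
    calc (omega ^ 2) ^ 2 = omega ^ 3 * omega := by ring
      _ = omega ^ 1 := by rw [h]; ring

theorem continuous_contraction (i : Fin 3) : Continuous (contraction i) := by
  unfold contraction; fun_prop

theorem contraction_vertex_mem (i : Fin 3) {z : ℂ} (hz : z ∈ prefractal 0) :
    contraction i z ∈ prefractal 0 := by
  have hv : vertex i ∈ convexHull ℝ (Set.range vertex) := subset_convexHull ℝ _ ⟨i, rfl⟩
  have := (convex_convexHull ℝ (Set.range vertex)) hz hv (a := 1 / 2) (b := 1 / 2)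
    (by norm_num) (by norm_num) (by norm_num)
  have e : contraction i z = (1 / 2 : ℝ) • z + (1 / 2 : ℝ) • vertex i := by
    simp [contraction]; ring
  change contraction i z ∈ convexHull ℝ (Set.range vertex)
  rw [e]; exact this

theorem prefractal_succ_subset (n : ℕ) : prefractal (n + 1) ⊆ prefractal n := by
  induction n with
  | zero =>
    intro x hx
    obtain ⟨i, z, hz, rfl⟩ := Set.mem_iUnion.1 hx
    exact contraction_vertex_mem i hz
  | succ n ih => exact Set.iUnion_mono fun i => Set.image_mono ih

theorem prefractal_antitone : Antitone prefractal := antitone_nat_of_succ_le prefractal_succ_subset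

theorem isCompact_prefractal (n : ℕ) : IsCompact (prefractal n) := by
  induction n with
  | zero => exact (Set.finite_range vertex).isCompact_convexHull ℝ
  | succ n ih => exact isCompact_iUnion fun i => ih.image (continuous_contraction i)

theorem isCompact_gasket : IsCompact gasket :=
  (isCompact_prefractal 0).of_isClosed_subset
    (isClosed_iInter fun n => (isCompact_prefractal n).isClosed) (Set.iInter_subset _ 0)

instance : CompactSpace gasket := isCompact_iff_compactSpace.1 isCompact_gasket

theorem contraction_mem (i : Fin 3) {z : ℂ} (hz : z ∈ gasket) : contraction i z ∈ gasket := by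
  refine Set.mem_iInter.2 fun n => prefractal_succ_subset n ?_
  exact Set.mem_iUnion.2 ⟨i, z, Set.mem_iInter.1 hz n, rfl⟩

theorem contraction_injective (i : Fin 3) : Function.Injective (contraction i) := by
  intro x y h
  simpa [contraction] using h

theorem exists_contraction {z : ℂ} (hz : z ∈ gasket) :
    ∃ i, ∃ y ∈ gasket, contraction i y = z := by
  have h : ∀ n, ∃ i, ∃ y ∈ prefractal n, contraction i y = z := fun n => by
    obtain ⟨i, y, hy, h⟩ := Set.mem_iUnion.1 (Set.mem_iInter.1 hz (n + 1))
    exact ⟨i, y, hy, h⟩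
  choose i y hy hz using h
  obtain ⟨j, hj⟩ := Finite.exists_infinite_fiber i
  rw [Set.infinite_coe_iff] at hj
  obtain ⟨n₀, hn₀⟩ := hj.nonempty
  refine ⟨j, y n₀, Set.mem_iInter.2 fun m => ?_, ?_⟩
  · obtain ⟨n, hn, hmn⟩ := hj.exists_gt m
    have e : y n = y n₀ := contraction_injective j (by
      have h1 := hz n
      have h2 := hz n₀
      simp only [Set.mem_preimage, Set.mem_singleton_iff] at hn hn₀
      rw [hn] at h1; rw [hn₀] at h2; rw [h1, h2])
    exact e ▸ prefractal_antitone hmn.le (hy n)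
  · have h2 := hz n₀
    simp only [Set.mem_preimage, Set.mem_singleton_iff] at hn₀
    rwa [hn₀] at h2

theorem vertex_mem (i : Fin 3) : vertex i ∈ gasket := by
  refine Set.mem_iInter.2 fun n => ?_
  induction n with
  | zero => exact subset_convexHull ℝ _ ⟨i, rfl⟩
  | succ n ih => exact Set.mem_iUnion.2 ⟨i, vertex i, ih, by simp [contraction]⟩

/-- The gasket is the attractor of the three contractions: it is compact, contains the
vertices (so it is not empty), and satisfies the self-similar identity. -/
theorem gasket_eq : gasket = ⋃ i, contraction i '' gasket := by
  ext z
  constructor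
  · intro hz
    obtain ⟨i, y, hy, h⟩ := exists_contraction hz
    exact Set.mem_iUnion.2 ⟨i, y, hy, h⟩
  · intro hz
    obtain ⟨i, y, hy, rfl⟩ := Set.mem_iUnion.1 hz
    exact contraction_mem i hy

theorem map_convexHull_vertex (f : ℂ →ₗ[ℝ] ℂ) (σ : Fin 3 → Fin 3)
    (hf : ∀ i, f (vertex i) = vertex (σ i)) {z : ℂ} (hz : z ∈ gasket) : f z ∈ gasket := by
  have key : ∀ n, ∀ z ∈ prefractal n, f z ∈ prefractal n := by
    intro n
    induction n with
    | zero =>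
      intro z hz
      have h1 : f z ∈ f '' convexHull ℝ (Set.range vertex) := ⟨z, hz, rfl⟩
      rw [f.image_convexHull] at h1
      refine convexHull_mono ?_ h1
      rintro _ ⟨_, ⟨i, rfl⟩, rfl⟩
      exact ⟨σ i, (hf i).symm⟩
    | succ n ih =>
      intro z hz
      obtain ⟨i, y, hy, rfl⟩ := Set.mem_iUnion.1 hz
      refine Set.mem_iUnion.2 ⟨σ i, f y, ih y hy, ?_⟩
      have e : ∀ i z, contraction i z = (1 / 2 : ℝ) • (z - vertex i) + vertex i := fun i z => by
        simp [contraction]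
      rw [e, e, map_add, map_smul, map_sub, hf]
  exact Set.mem_iInter.2 fun n => key n z (Set.mem_iInter.1 hz n)

/-- The map `Fᵢ` of the standard iterated function system, on `SG`. -/
noncomputable def gasketF (i : Fin 3) : C(gasket, gasket) where
  toFun x := ⟨contraction i x, contraction_mem i x.2⟩
  continuous_toFun := ((continuous_contraction i).comp continuous_subtype_val).subtype_mk _

/-- The rotation `z ↦ ωz` of `SG`. -/
noncomputable def gasketRot : C(gasket, gasket) where
  toFun x := ⟨omega * x, map_convexHull_vertex (LinearMap.mulLeft ℝ omega) (· + 1)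
    omega_mul_vertex x.2⟩
  continuous_toFun := by fun_prop

/-- The reflection `𝔠` of `SG` along the real axis. -/
noncomputable def gasketConj : C(gasket, gasket) where
  toFun x := ⟨(starRingEnd ℂ) x, map_convexHull_vertex Complex.conjAe.toLinearMap (- ·)
    conj_vertex x.2⟩
  continuous_toFun := (Complex.continuous_conj.comp continuous_subtype_val).subtype_mk _

/-- The twisted iterated function system `F̃₀ = F₀`, `F̃₁ = F₁ ∘ ω²`, `F̃₂ = F₂ ∘ ω` on `SG`. -/
noncomputable def twistedF : Fin 3 → C(gasket, gasket) :=
  ![gasketF 0, (gasketF 1).comp (gasketRot.comp gasketRot), (gasketF 2).comp gasketRot]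

theorem gasketRot_three (x : gasket) : gasketRot (gasketRot (gasketRot x)) = x := by
  apply Subtype.ext
  change omega * (omega * (omega * (x : ℂ))) = x
  linear_combination (x : ℂ) * omega_pow_three

theorem exists_twistedF (z : gasket) : ∃ i y, twistedF i y = z := by
  obtain ⟨i, y, hy, h⟩ := exists_contraction z.2
  have h' : gasketF i ⟨y, hy⟩ = z := Subtype.ext h
  fin_cases i
  · exact ⟨0, ⟨y, hy⟩, h'⟩
  · exact ⟨1, gasketRot ⟨y, hy⟩, by simpa [twistedF, gasketRot_three] using h'⟩
  · exact ⟨2, gasketRot (gasketRot ⟨y, hy⟩), by simpa [twistedF, gasketRot_three] using h'⟩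

theorem gasket_bounds {z : ℂ} (hz : z ∈ gasket) :
    -1 / 2 ≤ z.re ∧ -1 / 2 ≤ -z.re / 2 + √3 * z.im / 2 ∧ -1 / 2 ≤ -z.re / 2 - √3 * z.im / 2 := by
  have h3 : √3 * √3 = 3 := Real.mul_self_sqrt (by norm_num)
  have h0 : z ∈ convexHull ℝ (Set.range vertex) := Set.mem_iInter.1 hz 0
  have hc : Convex ℝ {z : ℂ | -1 / 2 ≤ z.re ∧ -1 / 2 ≤ -z.re / 2 + √3 * z.im / 2 ∧
      -1 / 2 ≤ -z.re / 2 - √3 * z.im / 2} := by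
    rintro x ⟨hx1, hx2, hx3⟩ y ⟨hy1, hy2, hy3⟩ a b ha hb hab
    have e : b = 1 - a := by linarith
    subst e
    refine ⟨?_, ?_, ?_⟩ <;> simp only [Complex.add_re, Complex.add_im, Complex.smul_re,
      Complex.smul_im, smul_eq_mul] <;> nlinarith
  refine convexHull_min ?_ hc h0
  rintro _ ⟨i, rfl⟩
  fin_cases i
  · simp [vertex]; norm_num
  · simp [vertex, omega_eq]; constructor <;> nlinarith
  · simp [vertex, omega_eq, pow_two]
    refine ⟨?_, ?_, ?_⟩ <;> nlinarith

theorem twistedF_zero (z : gasket) : (twistedF 0 z : ℂ).re = ((z : ℂ).re + 1) / 2 ∧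
    √3 * (twistedF 0 z : ℂ).im = √3 * (z : ℂ).im / 2 := by
  obtain ⟨⟨a, b⟩, hz⟩ := z
  simp [twistedF, gasketF, contraction, vertex]
  constructor <;> ring

theorem twistedF_one (z : gasket) :
    (twistedF 1 z : ℂ).re = (-(z : ℂ).re + √3 * (z : ℂ).im - 1) / 4 ∧
    √3 * (twistedF 1 z : ℂ).im = (-3 * (z : ℂ).re - √3 * (z : ℂ).im + 3) / 4 := by
  have h3 : √3 * √3 = 3 := Real.mul_self_sqrt (by norm_num)
  obtain ⟨⟨a, b⟩, hz⟩ := z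
  simp [twistedF, gasketF, gasketRot, contraction, vertex, omega_eq]
  constructor
  · linear_combination (-a / 8) * h3
  · linear_combination (-a / 4 + 1 / 4 - b * √3 / 8) * h3

theorem twistedF_two (z : gasket) :
    (twistedF 2 z : ℂ).re = (-(z : ℂ).re - √3 * (z : ℂ).im - 1) / 4 ∧
    √3 * (twistedF 2 z : ℂ).im = (3 * (z : ℂ).re - √3 * (z : ℂ).im - 3) / 4 := by
  have h3 : √3 * √3 = 3 := Real.mul_self_sqrt (by norm_num)
  obtain ⟨⟨a, b⟩, hz⟩ := z
  simp [twistedF, gasketF, gasketRot, contraction, vertex, omega_eq, pow_two]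
  constructor
  · linear_combination (-1 / 8) * h3
  · linear_combination (a / 4 - 1 / 4) * h3

/-- The inverse branches agree wherever two cells meet, so that they define one map. -/
theorem twistedF_eq {i j : Fin 3} {x y : gasket} (h : twistedF i x = twistedF j y) : x = y := by
  have hp : 0 < √3 := by positivity
  obtain ⟨hx1, hx2, hx3⟩ := gasket_bounds x.2
  obtain ⟨hy1, hy2, hy3⟩ := gasket_bounds y.2
  have hre := congrArg (fun z : gasket => (z : ℂ).re) h
  have him := congrArg (fun z : gasket => √3 * (z : ℂ).im) h
  suffices H : (x : ℂ).re = (y : ℂ).re ∧ √3 * (x : ℂ).im = √3 * (y : ℂ).im from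
    Subtype.ext (Complex.ext H.1 (mul_left_cancel₀ hp.ne' H.2))
  obtain ⟨x0, x0'⟩ := twistedF_zero x
  obtain ⟨x1, x1'⟩ := twistedF_one x
  obtain ⟨x2, x2'⟩ := twistedF_two x
  obtain ⟨y0, y0'⟩ := twistedF_zero y
  obtain ⟨y1, y1'⟩ := twistedF_one y
  obtain ⟨y2, y2'⟩ := twistedF_two y
  have hi : i = 0 ∨ i = 1 ∨ i = 2 := by omega
  have hj : j = 0 ∨ j = 1 ∨ j = 2 := by omega
  rcases hi with rfl | rfl | rfl <;> rcases hj with rfl | rfl | rfl <;>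
    constructor <;> linarith

theorem isQuotientMap_twistedF :
    Topology.IsQuotientMap (⇑(⟨fun p => twistedF p.1 p.2, by
      refine continuous_prod_of_discrete_left.2 fun i => ?_
      exact (twistedF i).continuous⟩ : C(Fin 3 × gasket, gasket))) := by
  refine IsClosedMap.isQuotientMap ?_ (map_continuous _) fun z => ?_
  · exact (map_continuous _).isClosedMap
  · obtain ⟨i, y, h⟩ := exists_twistedF z
    exact ⟨(i, y), h⟩

/-- The dynamical map `R` on `SG`: the continuous map whose inverse branch on the cell `Fᵢ SG`
is `F̃ᵢ`. -/
noncomputable def gasketR : C(gasket, gasket) :=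
  isQuotientMap_twistedF.lift ⟨Prod.snd, continuous_snd⟩ fun _ _ h => twistedF_eq h

theorem gasketR_twistedF (i : Fin 3) (x : gasket) : gasketR (twistedF i x) = x :=
  congrArg (fun f : C(Fin 3 × gasket, gasket) => f (i, x))
    (isQuotientMap_twistedF.lift_comp ⟨Prod.snd, continuous_snd⟩ fun _ _ h => twistedF_eq h)

/-! ### The rational map and its Julia set -/

/-- The rational map `R(z) = z² - 16/(27z)` on the Riemann sphere; its poles are `0` and `∞`. -/
noncomputable def rationalR (p : OnePoint ℂ) : OnePoint ℂ :=
  p.elim OnePoint.infty fun z =>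
    open Classical in if z = 0 then OnePoint.infty else ((z ^ 2 - 16 / (27 * z) : ℂ) : OnePoint ℂ)

/-- A sequence of self-maps of the Riemann sphere is normal on `U`: each subsequence has a
further subsequence that converges uniformly on compact subsets of `U`, with respect to the
unique uniformity of the sphere (the one of the chordal metric). -/
def IsNormalOn (f : ℕ → OnePoint ℂ → OnePoint ℂ) (U : Set (OnePoint ℂ)) : Prop :=
  letI : UniformSpace (OnePoint ℂ) := uniformSpaceOfCompactR1
  ∀ φ : ℕ → ℕ, StrictMono φ → ∃ ψ : ℕ → ℕ, StrictMono ψ ∧ ∃ g : OnePoint ℂ → OnePoint ℂ,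
    ∀ K ⊆ U, IsCompact K → TendstoUniformlyOn (fun n => f (φ (ψ n))) g Filter.atTop K

/-- The Julia set of `R`: the points without a neighbourhood on which the iterates of `R` form a
normal family. -/
def juliaR : Set (OnePoint ℂ) :=
  {p | ¬ ∃ U : Set (OnePoint ℂ), IsOpen U ∧ p ∈ U ∧ IsNormalOn (fun n => rationalR^[n]) U}

/-- `h` identifies `SG` with the Julia set of `R`: it is a homeomorphism onto the Julia set
that respects the threefold rotation and the reflection, and in which `F₀` is an inverse
branch of `R`. -/
structure IsJuliaIdentification (h : gasket → ℂ) : Prop where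
  continuous : Continuous h
  injective : Function.Injective h
  range_eq : Set.range (fun x => (h x : OnePoint ℂ)) = juliaR
  rot : ∀ x, h (gasketRot x) = omega * h x
  conj : ∀ x, h (gasketConj x) = (starRingEnd ℂ) (h x)
  branch : ∀ x, rationalR (h (gasketF 0 x)) = h x

/-! ### Energy forms -/

/-- A nondegenerate energy form on `SG` (a resistance form with continuous domain), given by its
quadratic form `u ↦ ℰ(u)` on `C(SG)` with value `∞` off the domain
`dom ℰ = {u ∈ C(SG) : ℰ(u) < ∞}`. -/
structure IsNondegenerateEnergyForm (E : C(gasket, ℝ) → ℝ≥0∞) : Prop where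
  /-- `ℰ` is a quadratic form on the linear space `dom ℰ`. -/
  smul : ∀ (t : ℝ) (u : C(gasket, ℝ)), E (t • u) = ENNReal.ofReal (t ^ 2) * E u
  parallelogram : ∀ u v : C(gasket, ℝ), E (u + v) + E (u - v) = 2 * E u + 2 * E v
  /-- The functions of zero energy are exactly the constants. -/
  eq_zero_iff : ∀ u : C(gasket, ℝ), E u = 0 ↔ ∃ c : ℝ, ∀ x, u x = c
  /-- The domain separates the points of `SG`. -/
  separates : ∀ x y : gasket, x ≠ y → ∃ u : C(gasket, ℝ), E u < ∞ ∧ u x ≠ u y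
  /-- The effective resistance between any two points is finite. -/
  resistance_lt : ∀ x y : gasket, ∃ C : ℝ, ∀ u : C(gasket, ℝ), E u < ∞ →
    (u x - u y) ^ 2 ≤ C * (E u).toReal
  /-- `dom ℰ` modulo constants is complete. -/
  complete : ∀ u : ℕ → C(gasket, ℝ), (∀ n, E (u n) < ∞) →
    (∀ ε : ℝ≥0∞, 0 < ε → ∃ N, ∀ m ≥ N, ∀ n ≥ N, E (u m - u n) < ε) →
    ∃ v : C(gasket, ℝ), E v < ∞ ∧ Filter.Tendsto (fun n => E (u n - v)) Filter.atTop (𝓝 0)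
  /-- The Markov property: truncation to `[0, 1]` does not increase the energy. -/
  markov : ∀ u v : C(gasket, ℝ), (∀ x, v x = max 0 (min 1 (u x))) → E v ≤ E u

/-- The self-similar identity `ℰ(u) = ∑ᵢ sᵢ⁻¹ ℰ(u ∘ F̃ᵢ)` with weights `s`. It is required for
every `u ∈ C(SG)`; so a continuous `u` lies in `dom ℰ` if and only if all `u ∘ F̃ᵢ` do. -/
def IsSelfSimilar (s : Fin 3 → ℝ) (E : C(gasket, ℝ) → ℝ≥0∞) : Prop :=
  ∀ u : C(gasket, ℝ), E u = ∑ i, ENNReal.ofReal (s i)⁻¹ * E (u.comp (twistedF i))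

/-- Symmetry under the reflection: `ℰ(u ∘ 𝔠) = ℰ(u)`. -/
def IsConjSymmetric (E : C(gasket, ℝ) → ℝ≥0∞) : Prop :=
  ∀ u : C(gasket, ℝ), E (u.comp gasketConj) = E u

/-- `R`-invariance with factor `ρ`: `ℰ(u ∘ R) = ρ ℰ(u)`. -/
def IsRInvariant (ρ : ℝ) (E : C(gasket, ℝ) → ℝ≥0∞) : Prop :=
  ∀ u : C(gasket, ℝ), E (u.comp gasketR) = ENNReal.ofReal ρ * E u

/-! The twist gives the junction point of the cells `i ≠ j` the label `i + j` in both cells, and the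
remaining corner `-i` of cell `i` is vertex `i`. Hence functions on the cells glue as soon as they
agree at equal labels. Moreover u ∘ R is a copy of u on every cell, so R-invariance is just the
self-similar identity applied to u ∘ R.

The rest reduces to a finite-dimensional eigenvalue problem. A nondegenerate form has a trace on the
three vertices, the energy of a resistor triangle with conductances `c` (`exists_trace`).
Self-similarity says that putting this triangle on the three cells, with the reciprocal weights, and
minimizing over the junction values gives the triangle back. Kirchhoff's laws for the equivalent
star turn this into linear equations. If `s 1 = s 2`, two current patterns already force `c 1 = c
2`, a quadratic equation for `x = c 0 / c 1` with exactly one positive root, and the value `s 0 / s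
1 + 2 / (2 * x + 1)` of `(s 1)⁻¹` (`eigenform_of_gap`). As `s 0 / s 1` does not depend on the
normalization, this fixes λ, and the trace up to a multiple. It also gives weights below one
(`one_lt_of_root`).

Weights below one make the graph energies control oscillations (`exists_abs_sub_corner_le`), and
then the trace determines the form: it is the limit of the graph energies
(`IsTrace.eq_limitEnergy`). Uniqueness follows, and so does symmetry, because the graph energies are
invariant under reflection. For existence, the same quadratic makes the graph energies of the
triangle `(x, 1, 1)` increase and stay constant on harmonic functions (`triangle_renormalization`).
These functions are continuous, and their interpolants are dense, so the limit is a form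
(`exists_form`).

Conversely, a test function supported in one cell shows that reflection symmetry forces `s 1 = s 2`.
For the rational map, the rule R(ωz) = ω²R(z) transfers the inverse branch on cell 0 to the other
cells. -/

/-! ### Geometry of the gasket -/

/-- The vertices of the gasket, as points of the gasket. -/
noncomputable def corner (i : Fin 3) : gasket := ⟨vertex i, vertex_mem i⟩

theorem corner_re_im (i : Fin 3) : (corner i : ℂ).re = ![1, -1 / 2, -1 / 2] i ∧
    √3 * (corner i : ℂ).im = ![0, 3 / 2, -3 / 2] i := by
  have h3 : √3 * √3 = 3 := Real.mul_self_sqrt (by norm_num)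
  fin_cases i
  · simp [corner, vertex]
  · simp [corner, vertex, omega_eq]; linarith
  · simp [corner, vertex, omega_eq, pow_two]; constructor <;> linarith

theorem gasket_ext {x y : gasket} (h1 : (x : ℂ).re = (y : ℂ).re)
    (h2 : √3 * (x : ℂ).im = √3 * (y : ℂ).im) : x = y :=
  Subtype.ext (Complex.ext h1 (mul_left_cancel₀ (by positivity) h2))

theorem twistedF_zero_corner : twistedF 0 (corner 0) = corner 0 := by
  obtain ⟨a, b⟩ := twistedF_zero (corner 0)
  obtain ⟨c, d⟩ := corner_re_im 0
  refine gasket_ext ?_ ?_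
  · rw [a, c]; simp
  · rw [b, d]; simp

theorem twistedF_one_corner : twistedF 1 (corner 2) = corner 1 := by
  obtain ⟨a, b⟩ := twistedF_one (corner 2)
  obtain ⟨c, d⟩ := corner_re_im 2
  obtain ⟨e, f⟩ := corner_re_im 1
  refine gasket_ext ?_ ?_
  · rw [a, c, d, e]; simp; norm_num
  · rw [b, c, d, f]; simp; norm_num

theorem twistedF_two_corner : twistedF 2 (corner 1) = corner 2 := by
  obtain ⟨a, b⟩ := twistedF_two (corner 1)
  obtain ⟨c, d⟩ := corner_re_im 2
  obtain ⟨e, f⟩ := corner_re_im 1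
  refine gasket_ext ?_ ?_
  · rw [a, c, f, e]; simp; norm_num
  · rw [b, d, f, e]; simp; norm_num

theorem twistedF_corner_neg (i : Fin 3) : twistedF i (corner (-i)) = corner i := by
  have hi : i = 0 ∨ i = 1 ∨ i = 2 := by omega
  rcases hi with rfl | rfl | rfl
  · exact twistedF_zero_corner
  · exact twistedF_one_corner
  · exact twistedF_two_corner

/-- The cells `i ≠ j` meet only in the image of the vertex with index `i + j`. -/
theorem eq_corner_of_twistedF_eq {i j : Fin 3} (hij : i ≠ j) {x y : gasket}
    (h : twistedF i x = twistedF j y) : x = corner (i + j) := by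
  have hxy := twistedF_eq h
  subst hxy
  obtain ⟨hx1, hx2, hx3⟩ := gasket_bounds x.2
  have hre := congrArg (fun z : gasket => (z : ℂ).re) h
  have him := congrArg (fun z : gasket => √3 * (z : ℂ).im) h
  obtain ⟨x0, x0'⟩ := twistedF_zero x
  obtain ⟨x1, x1'⟩ := twistedF_one x
  obtain ⟨x2, x2'⟩ := twistedF_two x
  obtain ⟨a0, b0⟩ := corner_re_im 0
  obtain ⟨a1, b1⟩ := corner_re_im 1
  obtain ⟨a2, b2⟩ := corner_re_im 2
  simp only [Matrix.cons_val_zero, Matrix.cons_val_one, Matrix.cons_val] at a0 b0 a1 b1 a2 b2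
  have hi : i = 0 ∨ i = 1 ∨ i = 2 := by omega
  have hj : j = 0 ∨ j = 1 ∨ j = 2 := by omega
  rcases hi with rfl | rfl | rfl <;> rcases hj with rfl | rfl | rfl <;>
    first
    | exact absurd rfl hij
    | (simp only [zero_add, add_zero, show (1 : Fin 3) + 2 = 0 from rfl,
        show (2 : Fin 3) + 1 = 0 from rfl]
       exact gasket_ext (by linarith) (by linarith))

/-- The rotations in `twistedF` make the two labels of a junction point coincide, so that `i + j`
names it from either side. -/
theorem twistedF_corner_eq {i j : Fin 3} (hij : i ≠ j) :
    twistedF i (corner (i + j)) = twistedF j (corner (i + j)) := by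
  obtain ⟨a0, b0⟩ := corner_re_im 0
  obtain ⟨a1, b1⟩ := corner_re_im 1
  obtain ⟨a2, b2⟩ := corner_re_im 2
  simp only [Matrix.cons_val_zero, Matrix.cons_val_one, Matrix.cons_val] at a0 b0 a1 b1 a2 b2
  have hi : i = 0 ∨ i = 1 ∨ i = 2 := by omega
  have hj : j = 0 ∨ j = 1 ∨ j = 2 := by omega
  have key : ∀ x : gasket, _ := fun x => And.intro (twistedF_zero x)
    (And.intro (twistedF_one x) (twistedF_two x))
  obtain ⟨⟨c1, c2⟩, ⟨c3, c4⟩, c5, c6⟩ := key (corner 0)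
  obtain ⟨⟨d1, d2⟩, ⟨d3, d4⟩, d5, d6⟩ := key (corner 1)
  obtain ⟨⟨e1, e2⟩, ⟨e3, e4⟩, e5, e6⟩ := key (corner 2)
  rcases hi with rfl | rfl | rfl <;> rcases hj with rfl | rfl | rfl <;>
    first
    | exact absurd rfl hij
    | (simp only [zero_add, add_zero, show (1 : Fin 3) + 2 = 0 from rfl,
        show (2 : Fin 3) + 1 = 0 from rfl]
       exact gasket_ext (by linarith) (by linarith))

theorem dist_twistedF (i : Fin 3) (x y : gasket) :
    dist (twistedF i x) (twistedF i y) = dist x y / 2 := by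
  have h0 : ∀ (i : Fin 3) (x y : gasket), dist (gasketF i x) (gasketF i y) = dist x y / 2 := by
    intro i x y
    rw [Subtype.dist_eq, Subtype.dist_eq, Complex.dist_eq, Complex.dist_eq]
    change ‖contraction i x - contraction i y‖ = _
    rw [show contraction i (x : ℂ) - contraction i y = (1 / 2) * ((x : ℂ) - y) by
      simp only [contraction]; ring, norm_mul]
    simp; ring
  have h1 : ∀ x y : gasket, dist (gasketRot x) (gasketRot y) = dist x y := by
    intro x y
    rw [Subtype.dist_eq, Subtype.dist_eq, Complex.dist_eq, Complex.dist_eq]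
    change ‖omega * x - omega * y‖ = _
    have : ‖omega‖ ^ 3 = 1 := by rw [← norm_pow, omega_pow_three, norm_one]
    rw [← mul_sub, norm_mul, (pow_eq_one_iff_of_nonneg (norm_nonneg _) (by norm_num)).1 this,
      one_mul]
  have hi : i = 0 ∨ i = 1 ∨ i = 2 := by omega
  rcases hi with rfl | rfl | rfl
  · exact h0 0 x y
  · change dist (gasketF 1 (gasketRot (gasketRot x))) (gasketF 1 (gasketRot (gasketRot y))) = _
    rw [h0, h1, h1]
  · change dist (gasketF 2 (gasketRot x)) (gasketF 2 (gasketRot y)) = _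
    rw [h0, h1]

theorem gasket_dist_le (x y : gasket) : dist x y ≤ 4 := by
  have h3 : √3 * √3 = 3 := Real.mul_self_sqrt (by norm_num)
  have hn : ∀ x : gasket, ‖(x : ℂ)‖ ≤ 2 := by
    intro x
    obtain ⟨hx1, hx2, hx3⟩ := gasket_bounds x.2
    refine (Complex.norm_le_abs_re_add_abs_im _).trans ?_
    have : |(x : ℂ).re| ≤ 1 := abs_le.2 ⟨by linarith, by linarith⟩
    have h4 : |√3 * (x : ℂ).im| ≤ 3 / 2 := abs_le.2 ⟨by linarith, by linarith⟩
    rw [abs_mul, abs_of_pos (by positivity : (0 : ℝ) < √3)] at h4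
    have h5 : (1.5 : ℝ) ≤ √3 := Real.le_sqrt_of_sq_le (by norm_num)
    nlinarith [abs_nonneg (x : ℂ).im]
  rw [Subtype.dist_eq]
  exact (dist_le_norm_add_norm _ _).trans (by linarith [hn x, hn y])

/-- No extra rotation appears, since conjugation turns the twist ω² of cell 1 into the twist ω of
cell 2. -/
theorem gasketConj_twistedF (i : Fin 3) (x : gasket) :
    gasketConj (twistedF i x) = twistedF (-i) (gasketConj x) := by
  have hr : ∀ x : gasket, (gasketConj x : ℂ).re = (x : ℂ).re := fun x => Complex.conj_re _
  have hm : ∀ x : gasket, (gasketConj x : ℂ).im = -(x : ℂ).im := fun x => Complex.conj_im _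
  have hi : i = 0 ∨ i = 1 ∨ i = 2 := by omega
  obtain ⟨a0, b0⟩ := twistedF_zero x
  obtain ⟨a1, b1⟩ := twistedF_one x
  obtain ⟨a2, b2⟩ := twistedF_two x
  obtain ⟨c0, d0⟩ := twistedF_zero (gasketConj x)
  obtain ⟨c1, d1⟩ := twistedF_one (gasketConj x)
  obtain ⟨c2, d2⟩ := twistedF_two (gasketConj x)
  rw [hr, hm] at c1 d1 c2 d2
  rw [hr] at c0
  rw [hm] at d0
  rcases hi with rfl | rfl | rfl
  · refine gasket_ext ?_ ?_ <;> simp only [neg_zero, hr, hm] <;> linarith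
  · refine gasket_ext ?_ ?_ <;> simp only [show (-1 : Fin 3) = 2 from rfl, hr, hm] <;> linarith
  · refine gasket_ext ?_ ?_ <;> simp only [show (-2 : Fin 3) = 1 from rfl, hr, hm] <;> linarith

theorem gasketConj_corner (i : Fin 3) : gasketConj (corner i) = corner (-i) :=
  Subtype.ext (conj_vertex i)

/-! ### Gluing functions on cells -/

/-- Functions on the three cells that agree at the junction points. -/
def Compatible (f : Fin 3 → C(gasket, ℝ)) : Prop :=
  ∀ i j, i ≠ j → f i (corner (i + j)) = f j (corner (i + j))

theorem exists_glue {f : Fin 3 → C(gasket, ℝ)} (hf : Compatible f) :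
    ∃ u : C(gasket, ℝ), ∀ i, u.comp (twistedF i) = f i := by
  let g : C(Fin 3 × gasket, ℝ) := ⟨fun p => f p.1 p.2,
    continuous_prod_of_discrete_left.2 fun i => (f i).continuous⟩
  have hg : ∀ a b : Fin 3 × gasket, twistedF a.1 a.2 = twistedF b.1 b.2 → g a = g b := by
    rintro ⟨i, x⟩ ⟨j, y⟩ h
    have hxy : x = y := twistedF_eq h
    subst hxy
    by_cases hij : i = j
    · rw [hij]
    · have hx : x = corner (i + j) := eq_corner_of_twistedF_eq hij h
      rw [hx]
      exact hf i j hij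
  refine ⟨isQuotientMap_twistedF.lift g hg, fun i => ContinuousMap.ext fun x => ?_⟩
  exact congrArg (fun F : C(Fin 3 × gasket, ℝ) => F (i, x)) (isQuotientMap_twistedF.lift_comp g hg)

open Classical in
/-- The function whose restrictions to the cells are given by `f`. -/
noncomputable def glue (f : Fin 3 → C(gasket, ℝ)) : C(gasket, ℝ) :=
  if hf : Compatible f then (exists_glue hf).choose else 0

theorem glue_comp {f : Fin 3 → C(gasket, ℝ)} (hf : Compatible f) (i : Fin 3) :
    (glue f).comp (twistedF i) = f i := by
  rw [glue, dif_pos hf]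
  exact (exists_glue hf).choose_spec i

theorem glue_apply {f : Fin 3 → C(gasket, ℝ)} (hf : Compatible f) (i : Fin 3) (x : gasket) :
    glue f (twistedF i x) = f i x := congrArg (fun g => g x) (glue_comp hf i)

theorem ext_comp {u v : C(gasket, ℝ)} (h : ∀ i, u.comp (twistedF i) = v.comp (twistedF i)) :
    u = v := by
  ext z
  obtain ⟨i, y, rfl⟩ := exists_twistedF z
  exact congrArg (fun g => g y) (h i)

theorem compatible_comp (u : C(gasket, ℝ)) : Compatible fun i => u.comp (twistedF i) :=
  fun _ _ hij => congrArg u (twistedF_corner_eq hij)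

/-- The values of a function at the vertices. -/
noncomputable def boundaryValues (u : C(gasket, ℝ)) : Fin 3 → ℝ := fun j => u (corner j)

theorem boundaryValues_comp (u : C(gasket, ℝ)) (i j : Fin 3) :
    boundaryValues (u.comp (twistedF i)) j = u (twistedF i (corner j)) := rfl

theorem compatible_of_boundaryValues {f g : Fin 3 → C(gasket, ℝ)} (hf : Compatible f)
    (h : ∀ i, boundaryValues (g i) = boundaryValues (f i)) : Compatible g := by
  intro i j hij
  have h1 := congrFun (h i) (i + j)
  have h2 := congrFun (h j) (i + j)
  simp only [boundaryValues] at h1 h2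
  rw [h1, h2, hf i j hij]

/-- Vertex `i` is the corner `-i` of cell `i`, so the corner values of the cells include the vertex
values. -/
theorem boundaryValues_ext {u v : C(gasket, ℝ)}
    (h : ∀ i, boundaryValues (u.comp (twistedF i)) = boundaryValues (v.comp (twistedF i))) :
    boundaryValues u = boundaryValues v := by
  ext i
  have h0 := congrFun (h i) (-i)
  rwa [boundaryValues_comp, boundaryValues_comp, twistedF_corner_neg] at h0

/-- Interpolation of a function at the level `n` vertices by copies of `H` on the cells. -/
noncomputable def interpolate (H : (Fin 3 → ℝ) → C(gasket, ℝ)) : ℕ → C(gasket, ℝ) → C(gasket, ℝ)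
  | 0, u => H (boundaryValues u)
  | n + 1, u => glue fun i => interpolate H n (u.comp (twistedF i))

theorem boundaryValues_interpolate {H : (Fin 3 → ℝ) → C(gasket, ℝ)}
    (hH : ∀ a, boundaryValues (H a) = a) (n : ℕ) (u : C(gasket, ℝ)) :
    boundaryValues (interpolate H n u) = boundaryValues u := by
  induction n generalizing u with
  | zero => exact hH _
  | succ n ih =>
    refine boundaryValues_ext fun i => ?_
    rw [interpolate, glue_comp (compatible_of_boundaryValues (compatible_comp u) fun i => ih _), ih]

theorem interpolate_succ_comp {H : (Fin 3 → ℝ) → C(gasket, ℝ)}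
    (hH : ∀ a, boundaryValues (H a) = a) (n : ℕ) (u : C(gasket, ℝ)) (i : Fin 3) :
    (interpolate H (n + 1) u).comp (twistedF i) = interpolate H n (u.comp (twistedF i)) := by
  rw [interpolate, glue_comp (compatible_of_boundaryValues (compatible_comp u) fun i =>
    boundaryValues_interpolate hH _ _)]

/-- Interpolation at level `n` reads only the vertices of level `n`, where the finer interpolant
agrees with `u`. -/
theorem interpolate_interpolate {H : (Fin 3 → ℝ) → C(gasket, ℝ)}
    (hH : ∀ a, boundaryValues (H a) = a) (n k : ℕ) (u : C(gasket, ℝ)) :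
    interpolate H n (interpolate H (n + k) u) = interpolate H n u := by
  induction n generalizing u with
  | zero => rw [interpolate, interpolate, boundaryValues_interpolate hH]
  | succ n ih =>
    refine ext_comp fun i => ?_
    rw [interpolate_succ_comp hH, show n + 1 + k = n + k + 1 by omega, interpolate_succ_comp hH,
      interpolate_succ_comp hH, ih]

/-- A uniform modulus of continuity on the cells of level `n` yields one for each first-level
restriction on the cells of level `n - 1`. -/
theorem modulus_comp {u : C(gasket, ℝ)} {ε : ℝ} {n : ℕ}
    (h : ∀ x y, dist x y ≤ 4 / 2 ^ (n + 1) → |u x - u y| ≤ ε) (i : Fin 3) :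
    ∀ x y, dist x y ≤ 4 / 2 ^ n → |u.comp (twistedF i) x - u.comp (twistedF i) y| ≤ ε := by
  intro x y hxy
  refine h _ _ ?_
  rw [dist_twistedF, pow_succ, ← div_div]
  linarith

/-- The scale is adapted to the cells: distances in the gasket are at most 4 and each cell map
halves them, so the condition covers all pairs of points in one cell of level `n`. -/
theorem exists_modulus (u : C(gasket, ℝ)) {ε : ℝ} (hε : 0 < ε) :
    ∃ n : ℕ, ∀ x y, dist x y ≤ 4 / 2 ^ n → |u x - u y| ≤ ε := by
  have hu := CompactSpace.uniformContinuous_of_continuous u.continuous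
  obtain ⟨δ, hδ, h⟩ := Metric.uniformContinuous_iff.1 hu ε hε
  obtain ⟨n, hn⟩ := exists_pow_lt_of_lt_one (show 0 < δ / 4 by positivity)
    (show (1 / 2 : ℝ) < 1 by norm_num)
  refine ⟨n, fun x y hxy => (h (hxy.trans_lt ?_)).le⟩
  rw [one_div, inv_pow] at hn
  rw [div_eq_mul_inv]
  linarith

/-! ### Energies on the approximating graphs -/

/-- The quadratic form of a triangle with conductance `c i` on the edge opposite to vertex `i`. -/
def triangleForm (c a : Fin 3 → ℝ) : ℝ :=
  c 0 * (a 1 - a 2) ^ 2 + c 1 * (a 0 - a 2) ^ 2 + c 2 * (a 0 - a 1) ^ 2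

/-- The energy of the level `n` graph, all of whose cells are copies of one triangle. -/
noncomputable def levelEnergy (c s : Fin 3 → ℝ) : ℕ → C(gasket, ℝ) → ℝ
  | 0, u => triangleForm c (boundaryValues u)
  | n + 1, u => ∑ i, (s i)⁻¹ * levelEnergy c s n (u.comp (twistedF i))

section LevelEnergy

variable {c s : Fin 3 → ℝ}

theorem triangleForm_nonneg (hc : ∀ i, 0 ≤ c i) (a : Fin 3 → ℝ) : 0 ≤ triangleForm c a := by
  have h0 := hc 0
  have h1 := hc 1
  have h2 := hc 2
  unfold triangleForm
  positivity

theorem levelEnergy_nonneg (hc : ∀ i, 0 ≤ c i) (hs : ∀ i, 0 < s i) (n : ℕ) (u : C(gasket, ℝ)) :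
    0 ≤ levelEnergy c s n u := by
  induction n generalizing u with
  | zero => exact triangleForm_nonneg hc _
  | succ n ih => exact Finset.sum_nonneg fun i _ => mul_nonneg (inv_nonneg.2 (hs i).le) (ih _)

theorem levelEnergy_smul (n : ℕ) (t : ℝ) (u : C(gasket, ℝ)) :
    levelEnergy c s n (t • u) = t ^ 2 * levelEnergy c s n u := by
  induction n generalizing u with
  | zero =>
    simp only [levelEnergy, triangleForm, boundaryValues, ContinuousMap.smul_apply, smul_eq_mul]
    ring
  | succ n ih =>
    simp only [levelEnergy]
    rw [Finset.mul_sum]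
    refine Finset.sum_congr rfl fun i _ => ?_
    rw [show (t • u).comp (twistedF i) = t • u.comp (twistedF i) from rfl, ih]
    ring

theorem levelEnergy_parallelogram (n : ℕ) (u v : C(gasket, ℝ)) :
    levelEnergy c s n (u + v) + levelEnergy c s n (u - v) =
      2 * levelEnergy c s n u + 2 * levelEnergy c s n v := by
  induction n generalizing u v with
  | zero =>
    simp only [levelEnergy, triangleForm, boundaryValues, ContinuousMap.add_apply,
      ContinuousMap.sub_apply]
    ring
  | succ n ih =>
    simp only [levelEnergy]
    rw [Finset.mul_sum, Finset.mul_sum, ← Finset.sum_add_distrib, ← Finset.sum_add_distrib]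
    refine Finset.sum_congr rfl fun i _ => ?_
    have := ih (u.comp (twistedF i)) (v.comp (twistedF i))
    rw [show (u + v).comp (twistedF i) = u.comp (twistedF i) + v.comp (twistedF i) from rfl,
      show (u - v).comp (twistedF i) = u.comp (twistedF i) - v.comp (twistedF i) from rfl]
    linear_combination (s i)⁻¹ * this

theorem levelEnergy_congr_weights (k : ℝ) (n : ℕ) (u : C(gasket, ℝ)) :
    levelEnergy (fun i => k * c i) s n u = k * levelEnergy c s n u := by
  induction n generalizing u with
  | zero => simp only [levelEnergy, triangleForm]; ring
  | succ n ih =>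
    simp only [levelEnergy, ih]
    rw [Finset.mul_sum]
    exact Finset.sum_congr rfl fun i _ => by ring

theorem levelEnergy_markov (hc : ∀ i, 0 ≤ c i) (hs : ∀ i, 0 < s i) (n : ℕ) {u v : C(gasket, ℝ)}
    (h : ∀ x, v x = max 0 (min 1 (u x))) : levelEnergy c s n v ≤ levelEnergy c s n u := by
  induction n generalizing u v with
  | zero =>
    have key : ∀ x y, (v x - v y) ^ 2 ≤ (u x - u y) ^ 2 := by
      intro x y
      rw [sq_le_sq, h, h]
      refine (abs_max_sub_max_le_max _ _ _ _).trans (max_le (by simp) ?_)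
      refine (abs_min_sub_min_le_max _ _ _ _).trans (max_le (by simp) le_rfl)
    simp only [levelEnergy, triangleForm, boundaryValues]
    have h0 := hc 0
    have h1 := hc 1
    have h2 := hc 2
    gcongr ?_ * ?_ + ?_ * ?_ + ?_ * ?_ <;> exact key _ _
  | succ n ih =>
    refine Finset.sum_le_sum fun i _ => mul_le_mul_of_nonneg_left (ih fun x => ?_)
      (inv_nonneg.2 (hs i).le)
    exact h _

theorem levelEnergy_eq_of_eq_add (n : ℕ) {u v : C(gasket, ℝ)} {t : ℝ} (h : ∀ x, v x = u x + t) :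
    levelEnergy c s n v = levelEnergy c s n u := by
  induction n generalizing u v with
  | zero => simp [levelEnergy, triangleForm, boundaryValues, h]
  | succ n ih =>
    exact Finset.sum_congr rfl fun i _ => congrArg _ (ih fun x => h _)

theorem levelEnergy_const (n : ℕ) {u : C(gasket, ℝ)} {t : ℝ} (h : ∀ x, u x = t) :
    levelEnergy c s n u = 0 := by
  have h0 := levelEnergy_smul (c := c) (s := s) n 0 (0 : C(gasket, ℝ))
  rw [levelEnergy_eq_of_eq_add (u := 0) (t := t) n (fun x => by simp [h]), ← zero_smul ℝ 0, h0]
  ring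

theorem tendsto_levelEnergy (n : ℕ) {w : ℕ → C(gasket, ℝ)} {v : C(gasket, ℝ)}
    (h : ∀ x, Filter.Tendsto (fun k => w k x) Filter.atTop (𝓝 (v x))) :
    Filter.Tendsto (fun k => levelEnergy c s n (w k)) Filter.atTop (𝓝 (levelEnergy c s n v)) := by
  induction n generalizing w v with
  | zero =>
    simp only [levelEnergy, triangleForm, boundaryValues]
    have := fun i => h (corner i)
    exact (((((this 1).sub (this 2)).pow 2).const_mul _).add
      ((((this 0).sub (this 2)).pow 2).const_mul _)).add
      ((((this 0).sub (this 1)).pow 2).const_mul _)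
  | succ n ih =>
    refine tendsto_finsetSum _ fun i _ => (ih fun x => ?_).const_mul _
    exact h _

theorem levelEnergy_comp_conj (hc : c 1 = c 2) (hs : s 1 = s 2) (n : ℕ) (u : C(gasket, ℝ)) :
    levelEnergy c s n (u.comp gasketConj) = levelEnergy c s n u := by
  induction n generalizing u with
  | zero =>
    have h0 : gasketConj (corner 0) = corner 0 := gasketConj_corner 0
    have h1 : gasketConj (corner 1) = corner 2 := gasketConj_corner 1
    have h2 : gasketConj (corner 2) = corner 1 := gasketConj_corner 2
    simp only [levelEnergy, triangleForm, boundaryValues, ContinuousMap.comp_apply, h0, h1, h2, hc]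
    ring
  | succ n ih =>
    have key : ∀ i, (u.comp gasketConj).comp (twistedF i) =
        (u.comp (twistedF (-i))).comp gasketConj := fun i =>
      ContinuousMap.ext fun x => congrArg u (gasketConj_twistedF i x)
    simp only [levelEnergy, key, ih, Fin.sum_univ_three, neg_zero, hs,
      show (-1 : Fin 3) = 2 from rfl, show (-2 : Fin 3) = 1 from rfl]
    ring

theorem abs_sub_le_of_triangleForm_le (hc : ∀ i, 0 < c i) :
    ∃ β : ℝ, 0 ≤ β ∧ ∀ (a : Fin 3 → ℝ) (M : ℝ), 0 ≤ M → triangleForm c a ≤ M ^ 2 →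
      ∀ j k, |a j - a k| ≤ β * M := by
  obtain ⟨b, hb, hbc⟩ : ∃ b, 0 < b ∧ ∀ i, b ≤ c i := by
    refine ⟨min (c 0) (min (c 1) (c 2)), lt_min (hc 0) (lt_min (hc 1) (hc 2)), fun i => ?_⟩
    fin_cases i <;> simp
  refine ⟨1 / √b, by positivity, fun a M hM h j k => ?_⟩
  suffices H : b * (a j - a k) ^ 2 ≤ M ^ 2 by
    refine abs_le_of_sq_le_sq ?_ (by positivity)
    rw [mul_pow, div_pow, Real.sq_sqrt hb.le, one_pow, one_div, inv_mul_eq_div, le_div_iff₀ hb]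
    linarith
  unfold triangleForm at h
  have hb0 := hbc 0
  have hb1 := hbc 1
  have hb2 := hbc 2
  have e0 : 0 ≤ (c 0 - b) * (a 1 - a 2) ^ 2 := mul_nonneg (by linarith) (sq_nonneg _)
  have e1 : 0 ≤ (c 1 - b) * (a 0 - a 2) ^ 2 := mul_nonneg (by linarith) (sq_nonneg _)
  have e2 : 0 ≤ (c 2 - b) * (a 0 - a 1) ^ 2 := mul_nonneg (by linarith) (sq_nonneg _)
  have f0 : 0 ≤ b * (a 1 - a 2) ^ 2 := by positivity
  have f1 : 0 ≤ b * (a 0 - a 2) ^ 2 := by positivity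
  have f2 : 0 ≤ b * (a 0 - a 1) ^ 2 := by positivity
  have hj : j = 0 ∨ j = 1 ∨ j = 2 := by omega
  have hk : k = 0 ∨ k = 1 ∨ k = 2 := by omega
  rcases hj with rfl | rfl | rfl <;> rcases hk with rfl | rfl | rfl <;> linarith

/-- Restricting to a cell multiplies an energy bound by the weight of the cell. -/
theorem levelEnergy_comp_le (hc : ∀ i, 0 ≤ c i) (hs : ∀ i, 0 < s i) (n : ℕ) (u : C(gasket, ℝ))
    (i : Fin 3) : levelEnergy c s n (u.comp (twistedF i)) ≤ s i * levelEnergy c s (n + 1) u := by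
  have h : (s i)⁻¹ * levelEnergy c s n (u.comp (twistedF i)) ≤ levelEnergy c s (n + 1) u :=
    Finset.single_le_sum (f := fun i => (s i)⁻¹ * levelEnergy c s n (u.comp (twistedF i)))
      (fun i _ => mul_nonneg (inv_nonneg.2 (hs i).le) (levelEnergy_nonneg hc hs _ _))
      (Finset.mem_univ i)
  rwa [inv_mul_le_iff₀ (hs i)] at h

/-- If the weights are less than one, then the oscillation of a function is controlled by its
energy. -/
theorem exists_abs_sub_corner_le (hc : ∀ i, 0 < c i) (hs : ∀ i, 0 < s i) (hs1 : ∀ i, s i < 1) :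
    ∃ K : ℝ, 0 ≤ K ∧ ∀ (u : C(gasket, ℝ)) (M : ℝ), 0 ≤ M →
      (∀ n, levelEnergy c s n u ≤ M ^ 2) → ∀ x, |u x - u (corner 0)| ≤ K * M := by
  obtain ⟨β, hβ, hbd⟩ := abs_sub_le_of_triangleForm_le hc
  -- Passing to any cell will replace the energy bound `M ^ 2` by `(τ * M) ^ 2`.
  obtain ⟨τ, hτ0, hτ1, hsτ⟩ : ∃ τ : ℝ, 0 ≤ τ ∧ τ < 1 ∧ ∀ i, s i ≤ τ ^ 2 := by
    refine ⟨√(max (s 0) (max (s 1) (s 2))), Real.sqrt_nonneg _, ?_, fun i => ?_⟩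
    · rw [Real.sqrt_lt' one_pos]
      simp [hs1]
    · rw [Real.sq_sqrt ((hs 0).le.trans (le_max_left _ _))]
      fin_cases i <;> simp
  have hc' : ∀ i, 0 ≤ c i := fun i => (hc i).le
  have hK : 0 ≤ 2 * β / (1 - τ) := div_nonneg (by positivity) (by linarith)
  -- Uniform continuity ends the recursion at depth `n` with error `ε`, which is removed afterwards.
  -- The constant `K = 2 * β / (1 - τ)` solves `K = τ * K + 2 * β`: descend into a cell, then return
  -- to `corner 0`.
  have key : ∀ (ε : ℝ) (n : ℕ) (u : C(gasket, ℝ)) (M : ℝ), 0 ≤ M →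
      (∀ x y, dist x y ≤ 4 / 2 ^ n → |u x - u y| ≤ ε) →
      (∀ n, levelEnergy c s n u ≤ M ^ 2) →
      ∀ x, |u x - u (corner 0)| ≤ 2 * β / (1 - τ) * M + ε := by
    intro ε n
    induction n with
    | zero =>
      intro u M hM hu _ x
      have := hu x (corner 0) (by simpa using gasket_dist_le _ _)
      have h2 : 0 ≤ 2 * β / (1 - τ) * M := mul_nonneg hK hM
      linarith
    | succ n ih =>
      intro u M hM hu hE x
      have hcomp : ∀ i k, levelEnergy c s k (u.comp (twistedF i)) ≤ (τ * M) ^ 2 := by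
        intro i k
        refine (levelEnergy_comp_le hc' hs k u i).trans ?_
        rw [mul_pow]
        exact mul_le_mul (hsτ i) (hE _) (levelEnergy_nonneg hc' hs _ _) (sq_nonneg _)
      have hstep : ∀ i j k, |u (twistedF i (corner j)) - u (twistedF i (corner k))| ≤ β * M := by
        intro i j k
        refine (hbd _ (τ * M) (by positivity) (hcomp i 0) j k).trans ?_
        have : τ * M ≤ M := by nlinarith
        exact mul_le_mul_of_nonneg_left this hβ
      -- Cross cell `i` to its junction with cell 0, then cross cell 0 to vertex 0: two steps of
      -- size at most `β * M`.
      have h0 : ∀ i, |u (twistedF i (corner 0)) - u (corner 0)| ≤ 2 * β * M := by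
        intro i
        have h1 := hstep i 0 (i + 0)
        have h2 := hstep 0 (i + 0) 0
        by_cases hi : i = 0
        · subst hi
          rw [twistedF_zero_corner, sub_self, abs_zero]
          positivity
        · rw [twistedF_corner_eq hi] at h1
          rw [twistedF_zero_corner] at h2
          calc _ ≤ _ := abs_sub_le _ _ _
            _ ≤ _ := add_le_add h1 h2
            _ = _ := by ring
      obtain ⟨i, y, rfl⟩ := exists_twistedF x
      have h3 := ih (u.comp (twistedF i)) (τ * M) (by positivity) (modulus_comp hu i) (hcomp i) y
      calc _ ≤ _ := abs_sub_le _ (u (twistedF i (corner 0))) _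
        _ ≤ (2 * β / (1 - τ) * (τ * M) + ε) + 2 * β * M := add_le_add h3 (h0 i)
        _ = _ := by
          have : 1 - τ ≠ 0 := by linarith
          field_simp
          ring
  refine ⟨_, hK, fun u M hM hE x => le_of_forall_pos_le_add fun ε hε => ?_⟩
  obtain ⟨n, hn⟩ := exists_modulus u hε
  exact key ε n u M hM hn hE x

/-- Each refinement subdivides the cells separately, so the inequality for one subdivision
propagates through the recursion. -/
theorem levelEnergy_monotone (hs : ∀ i, 0 < s i)
    (h : ∀ u, levelEnergy c s 0 u ≤ levelEnergy c s 1 u) (u : C(gasket, ℝ)) :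
    Monotone fun n => levelEnergy c s n u := by
  refine monotone_nat_of_le_succ fun n => ?_
  induction n generalizing u with
  | zero => exact h u
  | succ n ih =>
    exact Finset.sum_le_sum fun i _ => mul_le_mul_of_nonneg_left (ih _) (inv_nonneg.2 (hs i).le)

/-- The limit of the energies of the approximating graphs. -/
noncomputable def limitEnergy (c s : Fin 3 → ℝ) (u : C(gasket, ℝ)) : ℝ≥0∞ :=
  ⨆ n, ENNReal.ofReal (levelEnergy c s n u)

theorem limitEnergy_le {u : C(gasket, ℝ)} {M : ℝ} (hM : 0 ≤ M) :
    limitEnergy c s u ≤ ENNReal.ofReal M ↔ ∀ n, levelEnergy c s n u ≤ M := by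
  simp only [limitEnergy, iSup_le_iff, ENNReal.ofReal_le_ofReal_iff hM]

theorem tendsto_limitEnergy (hm : ∀ u, Monotone fun n => levelEnergy c s n u) (u : C(gasket, ℝ)) :
    Filter.Tendsto (fun n => ENNReal.ofReal (levelEnergy c s n u)) Filter.atTop
      (𝓝 (limitEnergy c s u)) :=
  tendsto_atTop_iSup fun _ _ h => ENNReal.ofReal_le_ofReal (hm u h)

/-- Between levels `n + 1` and `n` the identity is the definition. Monotonicity makes the suprema
limits, and limits pass through the finite sum. -/
theorem limitEnergy_isSelfSimilar (hc : ∀ i, 0 ≤ c i) (hs : ∀ i, 0 < s i)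
    (hm : ∀ u, Monotone fun n => levelEnergy c s n u) : IsSelfSimilar s (limitEnergy c s) := by
  intro u
  refine tendsto_nhds_unique ((tendsto_limitEnergy hm u).comp (Filter.tendsto_add_atTop_nat 1)) ?_
  have h : Filter.Tendsto (fun n => ∑ i, ENNReal.ofReal (s i)⁻¹ *
      ENNReal.ofReal (levelEnergy c s n (u.comp (twistedF i)))) Filter.atTop
      (𝓝 (∑ i, ENNReal.ofReal (s i)⁻¹ * limitEnergy c s (u.comp (twistedF i)))) :=
    tendsto_finsetSum _ fun i _ =>
      ENNReal.Tendsto.const_mul (tendsto_limitEnergy hm _) (Or.inr ENNReal.ofReal_ne_top)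
  refine h.congr fun n => ?_
  simp only [Function.comp, levelEnergy]
  rw [ENNReal.ofReal_sum_of_nonneg fun i _ => mul_nonneg (inv_nonneg.2 (hs i).le)
    (levelEnergy_nonneg hc hs _ _)]
  exact Finset.sum_congr rfl fun i _ => (ENNReal.ofReal_mul (inv_nonneg.2 (hs i).le)).symm

/-- The limit energy of a compatible sequence with enough functions of finite energy is a
nondegenerate energy form. -/
theorem limitEnergy_isNondegenerate (hc : ∀ i, 0 < c i) (hs : ∀ i, 0 < s i) (hs1 : ∀ i, s i < 1)
    (hm : ∀ u, Monotone fun n => levelEnergy c s n u)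
    (hd : ∀ (u : C(gasket, ℝ)) (ε : ℝ), 0 < ε →
      ∃ p : C(gasket, ℝ), (∀ x, |p x - u x| ≤ ε) ∧ limitEnergy c s p < ∞) :
    IsNondegenerateEnergyForm (limitEnergy c s) := by
  have hc' : ∀ i, 0 ≤ c i := fun i => (hc i).le
  have hnn := levelEnergy_nonneg hc' hs
  have hpar : ∀ u v, limitEnergy c s (u + v) + limitEnergy c s (u - v) =
      2 * limitEnergy c s u + 2 * limitEnergy c s v := by
    intro u v
    refine tendsto_nhds_unique ((tendsto_limitEnergy hm (u + v)).add
      (tendsto_limitEnergy hm (u - v))) ?_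
    refine ((ENNReal.Tendsto.const_mul (a := 2) (tendsto_limitEnergy hm u) (by simp)).add
      (ENNReal.Tendsto.const_mul (a := 2) (tendsto_limitEnergy hm v) (by simp))).congr fun n => ?_
    rw [← ENNReal.ofReal_add (hnn _ _) (hnn _ _), levelEnergy_parallelogram,
      ENNReal.ofReal_add (by linarith [hnn n u]) (by linarith [hnn n v]),
      ENNReal.ofReal_mul (by norm_num), ENNReal.ofReal_mul (by norm_num)]
    simp
  have hsmul : ∀ (t : ℝ) u, limitEnergy c s (t • u) = ENNReal.ofReal (t ^ 2) * limitEnergy c s u := by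
    intro t u
    simp only [limitEnergy, levelEnergy_smul, ENNReal.ofReal_mul (sq_nonneg t), ENNReal.mul_iSup]
  obtain ⟨K, hK, hosc⟩ := exists_abs_sub_corner_le hc hs hs1
  have hosc' : ∀ (u : C(gasket, ℝ)) (M : ℝ), 0 ≤ M → limitEnergy c s u ≤ ENNReal.ofReal (M ^ 2) →
      ∀ x, |u x - u (corner 0)| ≤ K * M := fun u M hM h =>
    hosc u M hM ((limitEnergy_le (sq_nonneg M)).1 h)
  have hconst : ∀ (u : C(gasket, ℝ)) (t : ℝ), (∀ x, u x = t) → limitEnergy c s u = 0 := by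
    intro u t h
    simp [limitEnergy, levelEnergy_const _ h]
  have haddc : ∀ (u v : C(gasket, ℝ)) (t : ℝ), (∀ x, v x = u x + t) →
      limitEnergy c s v ≤ limitEnergy c s u := by
    intro u v t h
    exact iSup_mono fun n => ENNReal.ofReal_le_ofReal (levelEnergy_eq_of_eq_add n h).le
  refine ⟨hsmul, hpar, ?_, ?_, ?_, ?_, ?_⟩
  · refine fun u => ⟨fun h => ⟨u (corner 0), fun x => ?_⟩, fun ⟨t, h⟩ => hconst u t h⟩
    have := hosc' u 0 le_rfl (by simp [h]) x
    rw [mul_zero, abs_nonpos_iff, sub_eq_zero] at this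
    exact this
  · intro x y hxy
    -- A finite-energy approximation of this function within a third of `dist y x` still separates
    -- the two points.
    let u : C(gasket, ℝ) := ⟨fun z => dist z x, by fun_prop⟩
    have hpos : 0 < dist y x := dist_pos.2 (Ne.symm hxy)
    obtain ⟨p, hp, hpE⟩ := hd u (dist y x / 3) (by positivity)
    refine ⟨p, hpE, fun h => ?_⟩
    have h1 := abs_le.1 (hp x)
    have h2 := abs_le.1 (hp y)
    have e1 : u x = 0 := dist_self x
    have e2 : u y = dist y x := rfl
    rw [e1] at h1
    rw [e2] at h2
    linarith [h1.2, h2.1]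
  · intro x y
    refine ⟨(2 * K) ^ 2, fun u hu => ?_⟩
    have h := hosc' u √(limitEnergy c s u).toReal (Real.sqrt_nonneg _)
      (by rw [Real.sq_sqrt ENNReal.toReal_nonneg, ENNReal.ofReal_toReal hu.ne])
    have h1 : |u x - u y| ≤ 2 * K * √(limitEnergy c s u).toReal := by
      have h2 := abs_sub_le (u x) (u (corner 0)) (u y)
      rw [abs_sub_comm (u (corner 0))] at h2
      linarith [h x, h y]
    calc (u x - u y) ^ 2 = |u x - u y| ^ 2 := (sq_abs _).symm
      _ ≤ (2 * K * √(limitEnergy c s u).toReal) ^ 2 := by gcongr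
      _ = _ := by rw [mul_pow, Real.sq_sqrt ENNReal.toReal_nonneg]
  · intro u hfin hcau
    -- After normalization at `corner 0`, the oscillation bound turns an energy Cauchy sequence into
    -- a uniform one.
    let w : ℕ → C(gasket, ℝ) := fun n => u n - ContinuousMap.const _ (u n (corner 0))
    have hw0 : ∀ n, w n (corner 0) = 0 := fun n => sub_self _
    have hwE : ∀ m n, limitEnergy c s (w m - w n) ≤ limitEnergy c s (u m - u n) := fun m n =>
      haddc _ _ (u n (corner 0) - u m (corner 0)) fun x => by simp [w]; ring
    have hwC : CauchySeq w := by
      refine Metric.cauchySeq_iff.2 fun ε hε => ?_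
      obtain ⟨N, hN⟩ := hcau (ENNReal.ofReal ((ε / (2 * (K + 1))) ^ 2))
        (ENNReal.ofReal_pos.2 (by positivity))
      refine ⟨N, fun m hm n hn => ?_⟩
      have h1 := hosc' (w m - w n) (ε / (2 * (K + 1))) (by positivity)
        ((hwE m n).trans (hN m hm n hn).le)
      refine lt_of_le_of_lt ((ContinuousMap.dist_le (C := ε / 2) (by positivity)).2 fun x => ?_)
        (by linarith)
      have h2 := h1 x
      rw [ContinuousMap.sub_apply (w m), ContinuousMap.sub_apply (w m), hw0, hw0, sub_zero,
        sub_zero] at h2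
      rw [Real.dist_eq]
      refine h2.trans ?_
      rw [mul_div_assoc', div_le_div_iff₀ (by positivity) (by positivity)]
      nlinarith
    obtain ⟨v, hv⟩ := cauchySeq_tendsto_of_complete hwC
    have hvx : ∀ x, Filter.Tendsto (fun n => w n x) Filter.atTop (𝓝 (v x)) := fun x =>
      ((ContinuousEvalConst.continuous_eval_const x).tendsto v).comp hv
    -- Lower semicontinuity: each graph energy depends on finitely many values, so the Cauchy bound
    -- survives the pointwise limit at every level and hence in the supremum.
    have hlim : ∀ δ : ℝ, 0 < δ → ∃ N, ∀ m ≥ N, limitEnergy c s (u m - v) ≤ ENNReal.ofReal δ := by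
      intro δ hδ
      obtain ⟨N, hN⟩ := hcau (ENNReal.ofReal δ) (ENNReal.ofReal_pos.2 hδ)
      refine ⟨N, fun m hm' => ?_⟩
      refine (haddc (w m - v) (u m - v) (u m (corner 0)) fun x => by simp [w]; ring).trans ?_
      refine (limitEnergy_le hδ.le).2 fun k => ?_
      refine le_of_tendsto (tendsto_levelEnergy (w := fun n => w m - w n) k fun x => ?_)
        (Filter.eventually_atTop.2 ⟨N, fun n hn => ?_⟩)
      · exact (hvx x).const_sub _
      · exact (limitEnergy_le hδ.le).1 ((hwE m n).trans (hN m hm' n hn).le) k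
    refine ⟨v, ?_, ?_⟩
    · obtain ⟨N, hN⟩ := hlim 1 one_pos
      have h1 := hN N le_rfl
      have h2 := hpar (u N) (u N - v)
      rw [sub_sub_cancel] at h2
      refine lt_of_le_of_lt (le_add_left le_rfl : _ ≤ limitEnergy c s (u N + (u N - v)) + _) ?_
      rw [h2]
      exact ENNReal.add_lt_top.2 ⟨ENNReal.mul_lt_top (by simp) (hfin N),
        ENNReal.mul_lt_top (by simp) (h1.trans_lt ENNReal.ofReal_lt_top)⟩
    · refine ENNReal.tendsto_atTop_zero.2 fun ε hε => ?_
      obtain ⟨δ, hδ, hδε⟩ := ENNReal.lt_iff_exists_real_btwn.1 hε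
      have hδ' : 0 < δ := ENNReal.ofReal_pos.1 hδε.1
      obtain ⟨N, hN⟩ := hlim δ hδ'
      exact ⟨N, fun n hn => (hN n hn).trans hδε.2.le⟩
  · exact fun u v h => iSup_mono fun n => ENNReal.ofReal_le_ofReal (levelEnergy_markov hc' hs n h)

end LevelEnergy

/-! ### Harmonic functions -/

theorem exists_bounds (a : Fin 3 → ℝ) : ∃ p q, ∀ j, a p ≤ a j ∧ a j ≤ a q := by
  obtain ⟨p, hp⟩ := Finite.exists_min a
  obtain ⟨q, hq⟩ := Finite.exists_max a
  exact ⟨p, q, fun j => ⟨hp j, hq j⟩⟩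

/-- The affine interpolation of values at the vertices. -/
noncomputable def affineExtension (a : Fin 3 → ℝ) : C(gasket, ℝ) where
  toFun z := a 0 * ((1 + 2 * (z : ℂ).re) / 3) + a 1 * ((1 - (z : ℂ).re + √3 * (z : ℂ).im) / 3) +
    a 2 * ((1 - (z : ℂ).re - √3 * (z : ℂ).im) / 3)
  continuous_toFun := by fun_prop

theorem boundaryValues_affineExtension (a : Fin 3 → ℝ) :
    boundaryValues (affineExtension a) = a := by
  ext j
  change a 0 * ((1 + 2 * (corner j : ℂ).re) / 3) + _ + _ = _
  obtain ⟨h1, h2⟩ := corner_re_im j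
  rw [h1, h2]
  have hj : j = 0 ∨ j = 1 ∨ j = 2 := by omega
  rcases hj with rfl | rfl | rfl <;> simp <;> ring

theorem affineExtension_mem {a : Fin 3 → ℝ} {l h : ℝ} (ha : ∀ j, l ≤ a j ∧ a j ≤ h) (z : gasket) :
    l ≤ affineExtension a z ∧ affineExtension a z ≤ h := by
  change l ≤ a 0 * ((1 + 2 * (z : ℂ).re) / 3) + a 1 * ((1 - (z : ℂ).re + √3 * (z : ℂ).im) / 3) +
    a 2 * ((1 - (z : ℂ).re - √3 * (z : ℂ).im) / 3) ∧ a 0 * ((1 + 2 * (z : ℂ).re) / 3) +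
    a 1 * ((1 - (z : ℂ).re + √3 * (z : ℂ).im) / 3) +
    a 2 * ((1 - (z : ℂ).re - √3 * (z : ℂ).im) / 3) ≤ h
  obtain ⟨h1, h2, h3⟩ := gasket_bounds z.2
  obtain ⟨p0, q0⟩ := ha 0
  obtain ⟨p1, q1⟩ := ha 1
  obtain ⟨p2, q2⟩ := ha 2
  constructor <;> nlinarith

/-- A consistent rule for the values at the junction points extends to continuous functions on
the gasket if it contracts oscillations. -/
theorem exists_harmonicExtension {A : Fin 3 → (Fin 3 → ℝ) → Fin 3 → ℝ}
    (hcompat : ∀ a i j, i ≠ j → A i a (i + j) = A j a (i + j))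
    (hfix : ∀ a i, A i a (-i) = a i)
    (hhull : ∀ a l h, (∀ j, l ≤ a j ∧ a j ≤ h) → ∀ i j, l ≤ A i a j ∧ A i a j ≤ h)
    {θ : ℝ} (hθ : θ < 1)
    (hosc : ∀ a K, (∀ j k, |a j - a k| ≤ K) → ∀ i j k, |A i a j - A i a k| ≤ θ * K) :
    ∃ H : (Fin 3 → ℝ) → C(gasket, ℝ), (∀ a, boundaryValues (H a) = a) ∧
      (∀ a i, (H a).comp (twistedF i) = H (A i a)) ∧
      ∀ a l h, (∀ j, l ≤ a j ∧ a j ≤ h) → ∀ x, l ≤ H a x ∧ H a x ≤ h := by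
  -- `G n` follows the rule through `n` levels and is affine inside the resulting cells.
  let G : ℕ → (Fin 3 → ℝ) → C(gasket, ℝ) := fun n =>
    n.rec affineExtension fun _ g a => glue fun i => g (A i a)
  have hG : ∀ n a, G (n + 1) a = glue fun i => G n (A i a) := fun _ _ => rfl
  have hcomp : ∀ {g : (Fin 3 → ℝ) → C(gasket, ℝ)}, (∀ a, boundaryValues (g a) = a) →
      ∀ a, Compatible fun i => g (A i a) := by
    intro g hg a i j hij
    have h1 := congrFun (hg (A i a)) (i + j)
    have h2 := congrFun (hg (A j a)) (i + j)
    rw [boundaryValues] at h1 h2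
    rw [h1, h2, hcompat a i j hij]
  have hGb : ∀ n a, boundaryValues (G n a) = a := by
    intro n
    induction n with
    | zero => exact boundaryValues_affineExtension
    | succ n ih =>
      intro a
      ext i
      rw [boundaryValues, ← twistedF_corner_neg, hG, glue_apply (hcomp ih a)]
      exact (congrFun (ih (A i a)) (-i)).trans (hfix a i)
  have hGc : ∀ n a i, (G (n + 1) a).comp (twistedF i) = G n (A i a) := fun n a i => by
    rw [hG, glue_comp (hcomp (hGb n) a)]
  have hGa : ∀ n a i x, G (n + 1) a (twistedF i x) = G n (A i a) x := fun n a i x =>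
    congrArg (fun f => f x) (hGc n a i)
  have hGh : ∀ n a l h, (∀ j, l ≤ a j ∧ a j ≤ h) → ∀ x, l ≤ G n a x ∧ G n a x ≤ h := by
    intro n
    induction n with
    | zero => exact fun a l h ha x => affineExtension_mem ha x
    | succ n ih =>
      intro a l h ha x
      obtain ⟨i, y, rfl⟩ := exists_twistedF x
      rw [hGa]
      exact ih _ _ _ (hhull a l h ha i) y
  -- On a cell of level `n`, both functions lie in the range of the same corner values, whose
  -- oscillation has shrunk to at most `K * θ ^ n`.
  have hstep : ∀ n a K, (∀ j k, |a j - a k| ≤ K) → ∀ x, |G n a x - G (n + 1) a x| ≤ K * θ ^ n := by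
    intro n
    induction n with
    | zero =>
      intro a K ha x
      obtain ⟨p, q, hpq⟩ := exists_bounds a
      obtain ⟨h1, h2⟩ := hGh 0 a _ _ hpq x
      obtain ⟨h3, h4⟩ := hGh (0 + 1) a _ _ hpq x
      have h5 := (abs_le.1 (ha q p)).2
      rw [pow_zero, mul_one, abs_le]
      constructor <;> linarith
    | succ n ih =>
      intro a K ha x
      obtain ⟨i, y, rfl⟩ := exists_twistedF x
      rw [hGa n a i y, hGa (n + 1) a i y]
      refine (ih _ _ (hosc a K ha i) y).trans_eq ?_
      ring
  have hcau : ∀ a, CauchySeq fun n => G n a := by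
    intro a
    obtain ⟨p, q, hpq⟩ := exists_bounds a
    have hK : ∀ j k, |a j - a k| ≤ a q - a p := fun j k => by
      rw [abs_le]
      constructor <;> linarith [hpq j, hpq k]
    refine cauchySeq_of_le_geometric θ (a q - a p) hθ fun n => ?_
    have h1 := hstep n a _ hK
    exact (ContinuousMap.dist_le ((abs_nonneg _).trans (h1 (corner 0)))).2 h1
  choose H hH using fun a => cauchySeq_tendsto_of_complete (hcau a)
  have hx : ∀ a x, Filter.Tendsto (fun n => G n a x) Filter.atTop (𝓝 (H a x)) := fun a x =>
    ((ContinuousEvalConst.continuous_eval_const x).tendsto (H a)).comp (hH a)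
  refine ⟨H, fun a => funext fun j => ?_, fun a i => ContinuousMap.ext fun x => ?_,
    fun a l h ha x => ⟨?_, ?_⟩⟩
  · refine tendsto_nhds_unique (hx a (corner j)) ?_
    exact tendsto_const_nhds.congr fun n => (congrFun (hGb n a) j).symm
  · refine tendsto_nhds_unique ((hx a (twistedF i x)).comp (Filter.tendsto_add_atTop_nat 1)) ?_
    exact (hx (A i a) x).congr fun n => (hGa n a i x).symm
  · exact ge_of_tendsto' (hx a x) fun n => (hGh n a l h ha x).1
  · exact le_of_tendsto' (hx a x) fun n => (hGh n a l h ha x).2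

/-- The values at the corners of cell `i`, from values `a` at the vertices and `m k` at the
junction point of the two cells `i ≠ j` with `i + j = k`. -/
def cellValues (m : Fin 3 → ℝ) (i : Fin 3) (a : Fin 3 → ℝ) : Fin 3 → ℝ :=
  fun k => if k = -i then a i else m k

/-- The single entry `a k` pulls the average away from a bound by at least `δ` times its own
distance from it. Taking `a k` extremal gives the strict contraction of oscillations. -/
theorem weightedAverage_mem {w a : Fin 3 → ℝ} {δ l h : ℝ} (hδ : 0 ≤ δ) (hw : ∀ j, δ ≤ w j)
    (hw1 : ∑ j, w j = 1) (ha : ∀ j, l ≤ a j ∧ a j ≤ h) (k : Fin 3) :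
    l + δ * (a k - l) ≤ ∑ j, w j * a j ∧ ∑ j, w j * a j ≤ h - δ * (h - a k) := by
  constructor
  · have h1 : ∑ j, w j * a j = l + ∑ j, w j * (a j - l) := by
      simp only [mul_sub, Finset.sum_sub_distrib]
      rw [← Finset.sum_mul, hw1]
      ring
    rw [h1]
    have h2 : w k * (a k - l) ≤ ∑ j, w j * (a j - l) :=
      Finset.single_le_sum (f := fun j => w j * (a j - l))
        (fun j _ => mul_nonneg (hδ.trans (hw j)) (by linarith [ha j]))
        (Finset.mem_univ k)
    have h3 : δ * (a k - l) ≤ w k * (a k - l) :=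
      mul_le_mul_of_nonneg_right (hw k) (by linarith [ha k])
    linarith
  · have h1 : ∑ j, w j * a j = h - ∑ j, w j * (h - a j) := by
      simp only [mul_sub, Finset.sum_sub_distrib]
      rw [← Finset.sum_mul, hw1]
      ring
    rw [h1]
    have h2 : w k * (h - a k) ≤ ∑ j, w j * (h - a j) :=
      Finset.single_le_sum (f := fun j => w j * (h - a j))
        (fun j _ => mul_nonneg (hδ.trans (hw j)) (by linarith [ha j]))
        (Finset.mem_univ k)
    have h3 : δ * (h - a k) ≤ w k * (h - a k) :=
      mul_le_mul_of_nonneg_right (hw k) (by linarith [ha k])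
    linarith

/-- Strictly positive averaging rules for the junction points have harmonic functions. -/
theorem exists_harmonicExtension_of_weights {W : Fin 3 → Fin 3 → ℝ} (hW : ∀ k j, 0 < W k j)
    (hW1 : ∀ k, ∑ j, W k j = 1) :
    ∃ H : (Fin 3 → ℝ) → C(gasket, ℝ), (∀ a, boundaryValues (H a) = a) ∧
      (∀ a i, (H a).comp (twistedF i) = H (cellValues (fun k => ∑ j, W k j * a j) i a)) ∧
      ∀ a l h, (∀ j, l ≤ a j ∧ a j ≤ h) → ∀ x, l ≤ H a x ∧ H a x ≤ h := by
  obtain ⟨δ, hδ, hδW⟩ : ∃ δ, 0 < δ ∧ ∀ k j, δ ≤ W k j := by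
    obtain ⟨p, hp⟩ := Finite.exists_min fun p : Fin 3 × Fin 3 => W p.1 p.2
    exact ⟨W p.1 p.2, hW _ _, fun k j => hp (k, j)⟩
  have hmid : ∀ (a : Fin 3 → ℝ) (l h : ℝ), (∀ j, l ≤ a j ∧ a j ≤ h) → ∀ k q,
      l + δ * (a q - l) ≤ ∑ j, W k j * a j ∧ ∑ j, W k j * a j ≤ h - δ * (h - a q) :=
    fun a l h ha k q =>
      weightedAverage_mem hδ.le (hδW k) (hW1 k) ha q
  refine exists_harmonicExtension (θ := 1 - δ) ?_ ?_ ?_ (by linarith) ?_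
  · intro a i j hij
    have h1 : i + j ≠ -i := by revert i j; decide
    have h2 : i + j ≠ -j := by revert i j; decide
    rw [cellValues, cellValues, if_neg h1, if_neg h2]
  · intro a i
    rw [cellValues, if_pos rfl]
  · intro a l h ha i j
    rw [cellValues]
    split_ifs
    · exact ha i
    · have h1 := hmid a l h ha j 0
      have h2 := ha 0
      constructor <;> nlinarith
  · intro a K ha i
    obtain ⟨p, q, hpq⟩ := exists_bounds a
    have hK := (abs_le.1 (ha q p)).2
    have hqp : a p ≤ a q := (hpq q).1
    have hδ1 : δ ≤ 1 := by
      have h1 := hW1 0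
      rw [Fin.sum_univ_three] at h1
      linarith [hδW 0 0, hW 0 1, hW 0 2]
    have hθK : (1 - δ) * (a q - a p) ≤ (1 - δ) * K :=
      mul_le_mul_of_nonneg_left hK (by linarith)
    have hK0 : 0 ≤ (1 - δ) * (a q - a p) := mul_nonneg (by linarith) (by linarith)
    intro j k
    -- Junction values stay `δ * (a q - a p)` away from both extremes, and only one corner of a cell
    -- keeps an old value. So two corner values differ by at most `(1 - δ) * (a q - a p)`.
    have hj1 := (hmid a _ _ hpq j q).1
    have hj2 := (hmid a _ _ hpq j p).2
    have hk1 := (hmid a _ _ hpq k q).1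
    have hk2 := (hmid a _ _ hpq k p).2
    have hi := hpq i
    have hpos : 0 ≤ δ * (a q - a p) := mul_nonneg hδ.le (by linarith)
    rw [cellValues, cellValues]
    split_ifs <;> rw [abs_le] <;> constructor <;> linarith

/-- In a cell of level `n` the corner values are within `ε` of `u x`, and the maximum principle `hh`
keeps the interpolant in that range. -/
theorem interpolate_abs_sub_le {H : (Fin 3 → ℝ) → C(gasket, ℝ)}
    (hH : ∀ a, boundaryValues (H a) = a)
    (hh : ∀ a l h, (∀ j, l ≤ a j ∧ a j ≤ h) → ∀ x, l ≤ H a x ∧ H a x ≤ h) {ε : ℝ} (n : ℕ)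
    {u : C(gasket, ℝ)} (hu : ∀ x y, dist x y ≤ 4 / 2 ^ n → |u x - u y| ≤ ε) (x : gasket) :
    |interpolate H n u x - u x| ≤ ε := by
  induction n generalizing u x with
  | zero =>
    have h1 : ∀ j, u x - ε ≤ boundaryValues u j ∧ boundaryValues u j ≤ u x + ε := fun j => by
      have h2 := abs_le.1 (hu (corner j) x (by simpa using gasket_dist_le _ _))
      rw [boundaryValues]
      constructor <;> linarith
    have h3 := hh _ _ _ h1 x
    rw [interpolate, abs_le]
    constructor <;> linarith
  | succ n ih =>
    obtain ⟨i, y, rfl⟩ := exists_twistedF x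
    have h1 := ih (modulus_comp hu i) y
    rw [← interpolate_succ_comp hH] at h1
    exact h1

/-! ### The symmetric eigenform -/

/-- The renormalized energy of values `a` at the vertices and `u, v, w` at the junction points
is the energy of `a` up to a sum of squares that vanishes for the harmonic values. -/
theorem triangle_renormalization {r x : ℝ} (hr : 0 < r) (hx : 0 < x)
    (hroot : 4 * x ^ 2 + 2 * (1 - r) * (1 + r) * x - (1 + r) ^ 2 = 0) (a0 a1 a2 u v w : ℝ) :
    (r + 2 / (2 * x + 1)) * (r⁻¹ * (x * (u - v) ^ 2 + (a0 - v) ^ 2 + (a0 - u) ^ 2) +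
      (x * (u - a1) ^ 2 + (w - a1) ^ 2 + (w - u) ^ 2) +
      (x * (a2 - v) ^ 2 + (w - v) ^ 2 + (w - a2) ^ 2)) =
    x * (a1 - a2) ^ 2 + (a0 - a2) ^ 2 + (a0 - a1) ^ 2 +
    (r + 2 / (2 * x + 1)) * (4 * (w - (u + v + a1 + a2) / 4) ^ 2 +
      (2 + r * (2 * x + 1)) / (4 * r) *
        (u + v - (4 * a0 + r * (2 * x + 1) * (a1 + a2)) / (2 + r * (2 * x + 1))) ^ 2 +
      ((2 * x + 1) + r * (x + 1)) / (2 * r) *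
        (u - v - x * r / ((2 * x + 1) + r * (x + 1)) * (a1 - a2)) ^ 2) := by
  have h1 : (2 * x + 1) ≠ 0 := by positivity
  have h2 : 2 + r * (2 * x + 1) ≠ 0 := by positivity
  have h3 : (2 * x + 1) + r * (x + 1) ≠ 0 := by positivity
  -- The vertex energy is `(2 * a0 - (a1 + a2)) ^ 2 / 2 + (x + 1 / 2) * (a1 - a2) ^ 2`, a part even
  -- and a part odd under reflection. The factor `r + 2 / (2 * x + 1)` is what the even part
  -- requires; the odd part then matches by `hroot`. The identity `hid` completes squares in `w`, `u
  -- + v` and `u - v`.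
  have hα : (r + 2 / (2 * x + 1)) * ((2 * x + 1) / (2 * (2 + r * (2 * x + 1)))) = 1 / 2 := by
    field_simp
    ring
  have hβ : (r + 2 / (2 * x + 1)) *
      ((x + 1) / 2 - x ^ 2 * r / (2 * ((2 * x + 1) + r * (x + 1)))) = x + 1 / 2 := by
    field_simp
    linear_combination (-(2 * x + 1)) * hroot
  have hid : r⁻¹ * (x * (u - v) ^ 2 + (a0 - v) ^ 2 + (a0 - u) ^ 2) +
      (x * (u - a1) ^ 2 + (w - a1) ^ 2 + (w - u) ^ 2) +
      (x * (a2 - v) ^ 2 + (w - v) ^ 2 + (w - a2) ^ 2) =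
      (4 * (w - (u + v + a1 + a2) / 4) ^ 2 +
      (2 + r * (2 * x + 1)) / (4 * r) *
        (u + v - (4 * a0 + r * (2 * x + 1) * (a1 + a2)) / (2 + r * (2 * x + 1))) ^ 2 +
      ((2 * x + 1) + r * (x + 1)) / (2 * r) *
        (u - v - x * r / ((2 * x + 1) + r * (x + 1)) * (a1 - a2)) ^ 2) +
      (2 * x + 1) / (2 * (2 + r * (2 * x + 1))) * (2 * a0 - (a1 + a2)) ^ 2 +
      ((x + 1) / 2 - x ^ 2 * r / (2 * ((2 * x + 1) + r * (x + 1)))) * (a1 - a2) ^ 2 := by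
    field_simp
    ring
  rw [hid]
  linear_combination (2 * a0 - (a1 + a2)) ^ 2 * hα + (a1 - a2) ^ 2 * hβ

/-- The constant term is negative, so the larger root is positive. -/
theorem exists_root {r : ℝ} (hr : 0 < r) :
    ∃ x : ℝ, 0 < x ∧ 4 * x ^ 2 + 2 * (1 - r) * (1 + r) * x - (1 + r) ^ 2 = 0 := by
  have hs := Real.sq_sqrt (show 0 ≤ ((1 - r) * (1 + r)) ^ 2 + 4 * (1 + r) ^ 2 by positivity)
  refine ⟨(-((1 - r) * (1 + r)) + √(((1 - r) * (1 + r)) ^ 2 + 4 * (1 + r) ^ 2)) / 4, ?_, ?_⟩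
  · have : (1 - r) * (1 + r) < √(((1 - r) * (1 + r)) ^ 2 + 4 * (1 + r) ^ 2) :=
      Real.lt_sqrt_of_sq_lt (by nlinarith)
    linarith
  · linear_combination (1 / 4) * hs

/-- The quadratic reads `(1 + r) * ((1 + r) + 2 * (r - 1) * x) = 4 * x ^ 2`, and its second factor
is the numerator of `r + 2 / (2 * x + 1) - 1`. -/
theorem one_lt_of_root {r x : ℝ} (hr : 0 < r) (hx : 0 < x)
    (hroot : 4 * x ^ 2 + 2 * (1 - r) * (1 + r) * x - (1 + r) ^ 2 = 0) :
    1 < r + 2 / (2 * x + 1) := by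
  have h1 : 0 < (1 + r) * ((1 + r) + 2 * (r - 1) * x) := by
    have : (1 + r) * ((1 + r) + 2 * (r - 1) * x) = 4 * x ^ 2 := by linear_combination -hroot
    rw [this]
    positivity
  have h2 := pos_of_mul_pos_right h1 (by positivity)
  have h3 : r + 2 / (2 * x + 1) - 1 = ((1 + r) + 2 * (r - 1) * x) / (2 * x + 1) := by
    field_simp
    ring
  have h4 : 0 < ((1 + r) + 2 * (r - 1) * x) / (2 * x + 1) := by positivity
  linarith

/-- Existence of the self-similar form for weights with `s 1 = s 2` on the critical curve. -/
theorem exists_form {r x : ℝ} (hr : 0 < r) (hx : 0 < x)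
    (hroot : 4 * x ^ 2 + 2 * (1 - r) * (1 + r) * x - (1 + r) ^ 2 = 0) {s : Fin 3 → ℝ}
    (h0 : s 0 = (r + 2 / (2 * x + 1))⁻¹ * r) (h1 : s 1 = (r + 2 / (2 * x + 1))⁻¹)
    (h2 : s 2 = (r + 2 / (2 * x + 1))⁻¹) :
    ∃ E, IsNondegenerateEnergyForm E ∧ IsSelfSimilar s E := by
  set L := r + 2 / (2 * x + 1) with hL
  have hL1 : 1 < L := one_lt_of_root hr hx hroot
  have hLr : r < L := by
    have : 0 < 2 / (2 * x + 1) := by positivity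
    linarith
  have hL0 : 0 < L := by linarith
  let c : Fin 3 → ℝ := ![x, 1, 1]
  have hc : ∀ i, 0 < c i := fun i => by fin_cases i <;> simp [c, hx]
  have hs : ∀ i, 0 < s i := fun i => by
    have hi : i = 0 ∨ i = 1 ∨ i = 2 := by omega
    rcases hi with rfl | rfl | rfl <;> simp only [h0, h1, h2] <;> positivity
  have hs1 : ∀ i, s i < 1 := fun i => by
    have hi : i = 0 ∨ i = 1 ∨ i = 2 := by omega
    rcases hi with rfl | rfl | rfl <;> simp only [h0, h1, h2]
    · rwa [inv_mul_lt_one₀ hL0]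
    · exact inv_lt_one_of_one_lt₀ hL1
    · exact inv_lt_one_of_one_lt₀ hL1
  have hsum : ∀ f : Fin 3 → Fin 3 → ℝ, ∑ i, (s i)⁻¹ * triangleForm c (f i) =
      L * (r⁻¹ * (x * (f 0 1 - f 0 2) ^ 2 + (f 0 0 - f 0 2) ^ 2 + (f 0 0 - f 0 1) ^ 2) +
      (x * (f 1 1 - f 1 2) ^ 2 + (f 1 0 - f 1 2) ^ 2 + (f 1 0 - f 1 1) ^ 2) +
      (x * (f 2 1 - f 2 2) ^ 2 + (f 2 0 - f 2 2) ^ 2 + (f 2 0 - f 2 1) ^ 2)) := by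
    intro f
    rw [Fin.sum_univ_three, h0, h1, h2]
    simp only [triangleForm, c, Matrix.cons_val_zero, Matrix.cons_val_one, Matrix.cons_val]
    rw [mul_inv, inv_inv]
    ring
  have hmono : ∀ u, levelEnergy c s 0 u ≤ levelEnergy c s 1 u := by
    intro u
    have e01 := congrArg u (twistedF_corner_eq (i := 0) (j := 1) (by decide))
    have e02 := congrArg u (twistedF_corner_eq (i := 0) (j := 2) (by decide))
    have e12 := congrArg u (twistedF_corner_eq (i := 1) (j := 2) (by decide))
    rw [show (0 : Fin 3) + 1 = 1 from rfl] at e01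
    rw [show (0 : Fin 3) + 2 = 2 from rfl] at e02
    rw [show (1 : Fin 3) + 2 = 0 from rfl] at e12
    have key := triangle_renormalization hr hx hroot (u (corner 0)) (u (corner 1)) (u (corner 2))
      (u (twistedF 0 (corner 1))) (u (twistedF 0 (corner 2))) (u (twistedF 1 (corner 0)))
    simp only [levelEnergy]
    rw [hsum]
    simp only [boundaryValues_comp, twistedF_zero_corner, twistedF_one_corner, twistedF_two_corner,
      ← e01, ← e02, ← e12]
    rw [key, ← hL]
    have hcorner : triangleForm c (boundaryValues u) = x * (u (corner 1) - u (corner 2)) ^ 2 +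
      (u (corner 0) - u (corner 2)) ^ 2 + (u (corner 0) - u (corner 1)) ^ 2 := by
      simp [triangleForm, c, boundaryValues]
    rw [hcorner]
    exact le_add_of_nonneg_right (by positivity)
  set T := 2 + r * (2 * x + 1) with hT
  set κ := x * r / ((2 * x + 1) + r * (x + 1)) with hκ
  have hT0 : 0 < T := by positivity
  -- This keeps the smallest averaging weights strictly positive, as the contraction of oscillations
  -- requires.
  have hκT : κ < r * (2 * x + 1) / T := by
    rw [hκ, div_lt_div_iff₀ (by positivity) hT0]
    have : 0 < r * ((2 * x + 1) * ((2 * x + 1) + r * (x + 1)) - x * T) := by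
      refine mul_pos hr ?_
      rw [hT]
      have : (2 * x + 1) * ((2 * x + 1) + r * (x + 1)) - x * (2 + r * (2 * x + 1)) =
        4 * x ^ 2 + 2 * x + 1 + r * (2 * x + 1) := by ring
      rw [this]
      positivity
    nlinarith
  have hκ0 : 0 < κ := by positivity
  -- Rows 0, 1, 2 are the values `w`, `u`, `v` for which the three squares in
  -- `triangle_renormalization` vanish.
  let W : Fin 3 → Fin 3 → ℝ := ![
    ![1 / T, r * (2 * x + 1) / (4 * T) + 1 / 4, r * (2 * x + 1) / (4 * T) + 1 / 4],
    ![2 / T, (r * (2 * x + 1) / T + κ) / 2, (r * (2 * x + 1) / T - κ) / 2],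
    ![2 / T, (r * (2 * x + 1) / T - κ) / 2, (r * (2 * x + 1) / T + κ) / 2]]
  have hW : ∀ k j, 0 < W k j := by
    have e1 : 0 < (r * (2 * x + 1) / T - κ) / 2 := by linarith
    intro k j
    fin_cases k <;> fin_cases j <;> simp only [W, Fin.zero_eta, Fin.mk_one, Fin.reduceFinMk,
      Matrix.cons_val_zero, Matrix.cons_val_one, Matrix.cons_val] <;>
      first | exact e1 | positivity
  have hW1 : ∀ k, ∑ j, W k j = 1 := by
    intro k
    rw [Fin.sum_univ_three]
    fin_cases k <;> simp only [W, Fin.zero_eta, Fin.mk_one, Fin.reduceFinMk,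
      Matrix.cons_val_zero, Matrix.cons_val_one, Matrix.cons_val] <;> field_simp <;> rw [hT] <;> ring
  obtain ⟨H, hHb, hHc, hHh⟩ := exists_harmonicExtension_of_weights hW hW1
  have hHE : ∀ n a, levelEnergy c s n (H a) = triangleForm c a := by
    intro n
    induction n with
    | zero => exact fun a => by rw [levelEnergy, hHb]
    | succ n ih =>
      intro a
      simp only [levelEnergy, hHc, ih]
      rw [hsum]
      have key := triangle_renormalization hr hx hroot (a 0) (a 1) (a 2)
        (∑ j, W 1 j * a j) (∑ j, W 2 j * a j) (∑ j, W 0 j * a j)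
      have z1 : ∑ j, W 0 j * a j - (∑ j, W 1 j * a j + ∑ j, W 2 j * a j + a 1 + a 2) / 4 = 0 := by
        simp only [Fin.sum_univ_three, W, Matrix.cons_val_zero, Matrix.cons_val_one,
          Matrix.cons_val]
        field_simp
        ring
      have z2 : ∑ j, W 1 j * a j + ∑ j, W 2 j * a j -
          (4 * a 0 + r * (2 * x + 1) * (a 1 + a 2)) / T = 0 := by
        simp only [Fin.sum_univ_three, W, Matrix.cons_val_zero, Matrix.cons_val_one,
          Matrix.cons_val]
        field_simp
        ring
      have z3 : ∑ j, W 1 j * a j - ∑ j, W 2 j * a j - κ * (a 1 - a 2) = 0 := by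
        simp only [Fin.sum_univ_three, W, Matrix.cons_val_zero, Matrix.cons_val_one,
          Matrix.cons_val]
        field_simp
        ring
      rw [← hL, ← hT, ← hκ, z1, z2, z3] at key
      simp only [cellValues, triangleForm, c, Matrix.cons_val_zero, Matrix.cons_val_one,
        Matrix.cons_val]
      simp only [neg_zero, if_true, show (-1 : Fin 3) = 2 from rfl, show (-2 : Fin 3) = 1 from rfl,
        show ((1 : Fin 3) = 0) = False from by decide, show ((2 : Fin 3) = 0) = False from by decide,
        show ((0 : Fin 3) = 1) = False from by decide, show ((0 : Fin 3) = 2) = False from by decide,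
        show ((1 : Fin 3) = 2) = False from by decide, show ((2 : Fin 3) = 1) = False from by decide,
        if_false]
      linear_combination key
  have hm := levelEnergy_monotone hs hmono
  -- Beyond level `n` the interpolant is harmonic in each cell, so its energy no longer grows.
  -- Interpolants are thus the uniformly dense functions of finite energy.
  have hP : ∀ n k u, levelEnergy c s (n + k) (interpolate H n u) = levelEnergy c s n u := by
    intro n k
    induction n with
    | zero => exact fun u => by rw [zero_add, interpolate, hHE, levelEnergy]
    | succ n ih =>
      intro u
      rw [Nat.add_right_comm]
      simp only [levelEnergy]
      refine Finset.sum_congr rfl fun i _ => ?_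
      rw [interpolate_succ_comp hHb, ih]
  refine ⟨limitEnergy c s, limitEnergy_isNondegenerate hc hs hs1 hm fun u ε hε => ?_,
    limitEnergy_isSelfSimilar (fun i => (hc i).le) hs hm⟩
  obtain ⟨n, hn⟩ := exists_modulus u hε
  refine ⟨interpolate H n u, interpolate_abs_sub_le hHb hHh n hn, ?_⟩
  refine lt_of_le_of_lt ?_ (ENNReal.ofReal_lt_top (r := levelEnergy c s n u))
  refine (limitEnergy_le (levelEnergy_nonneg (fun i => (hc i).le) hs _ _)).2 fun k => ?_
  exact (hm _ (Nat.le_add_left k n)).trans (hP n k u).le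

/-! ### Quadratic forms from the parallelogram law -/

/-- Jordan–von Neumann: a nonnegative, homogeneous function with the parallelogram law is a
quadratic form. -/
theorem exists_bilinear_of_parallelogram {V : Type*} [AddCommGroup V] [Module ℝ V] {q : V → ℝ}
    (hq : ∀ u, 0 ≤ q u) (hsmul : ∀ (t : ℝ) u, q (t • u) = t ^ 2 * q u)
    (hpar : ∀ u v, q (u + v) + q (u - v) = 2 * q u + 2 * q v) :
    ∃ B : V →ₗ[ℝ] V →ₗ[ℝ] ℝ, (∀ u v, B u v = B v u) ∧ ∀ u, B u u = q u := by
  let b : V → V → ℝ := fun u v => (q (u + v) - q (u - v)) / 4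
  have hneg : ∀ u v, q (u - v) = q (v - u) := fun u v => by
    have := hsmul (-1) (v - u)
    rw [neg_one_smul, neg_sub] at this
    linarith
  have hsymm : ∀ u v, b u v = b v u := fun u v => by
    simp only [b]
    rw [add_comm u v, hneg]
  have hadd : ∀ u w v, b (u + w) v = b u v + b w v := by
    intro u w v
    have h1 := hpar (u + v) w
    have h2 := hpar (u - v) w
    have h3 := hpar (w + v) u
    have h4 := hpar (w - v) u
    have e1 := hneg (u + v) w
    have e2 := hneg (u - v) w
    simp only [b]
    rw [show u + v + w = u + w + v by abel] at h1
    rw [show u - v + w = u + w - v by abel] at h2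
    rw [show w + v + u = u + w + v by abel, show w + v - u = w - (u - v) by abel] at h3
    rw [show w - v + u = u + w - v by abel, show w - v - u = w - (u + v) by abel] at h4
    linarith
  have hbd : ∀ (t : ℝ) u v, |b (t • u) v| ≤ (t ^ 2 * q u + q v) / 2 := by
    intro t u v
    have h1 := hpar (t • u) v
    rw [hsmul] at h1
    have h2 := hq (t • u + v)
    have h3 := hq (t • u - v)
    rw [abs_le]
    simp only [b]
    constructor <;> linarith
  have hmul : ∀ (t : ℝ) u v, b (t • u) v = t * b u v := by
    intro t u v
    -- An additive function on ℝ that is bounded near 0 is continuous, hence linear.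
    let f : ℝ →+ ℝ := AddMonoidHom.mk' (fun t => b (t • u) v) fun x y => by
      rw [add_smul, hadd]
    have hf : Continuous f := by
      refine f.continuous_of_isBounded_nhds_zero (Metric.closedBall_mem_nhds 0 one_pos) ?_
      refine (Metric.isBounded_closedBall (x := (0 : ℝ)) (r := (q u + q v) / 2)).subset ?_
      rintro _ ⟨t, ht, rfl⟩
      rw [mem_closedBall_zero_iff, Real.norm_eq_abs] at ht ⊢
      refine (hbd t u v).trans ?_
      have : t ^ 2 ≤ 1 := by rwa [sq_le_one_iff_abs_le_one]
      nlinarith [hq u]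
    have := map_real_smul f hf t 1
    simpa [f] using this
  refine ⟨LinearMap.mk₂ ℝ b hadd (fun t u v => hmul t u v) (fun u v w => ?_) (fun t u v => ?_),
    hsymm, fun u => ?_⟩
  · rw [hsymm, hadd, hsymm v, hsymm w]
  · rw [hsymm, hmul, hsymm v]
    rfl
  · change (q (u + u) - q (u - u)) / 4 = q u
    have h0 := hsmul 0 u
    have h2 := hsmul 2 u
    rw [zero_smul] at h0
    rw [two_smul] at h2
    rw [sub_self, h0, h2]
    ring

theorem sq_le_mul_of_quadratic_nonneg {a b c : ℝ} (h : ∀ t : ℝ, 0 ≤ a * t ^ 2 + 2 * b * t + c) :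
    b ^ 2 ≤ a * c := by
  have := discrim_le_zero (a := a) (b := 2 * b) (c := c) fun t => by linarith [h t]
  rw [discrim] at this
  linarith

section Bilinear

variable {V : Type*} [AddCommGroup V] [Module ℝ V] {B : V →ₗ[ℝ] V →ₗ[ℝ] ℝ}

theorem bilinear_add_smul (hs : ∀ u v, B u v = B v u) (u v : V) (t : ℝ) :
    B (u + t • v) (u + t • v) = B v v * t ^ 2 + 2 * B u v * t + B u u := by
  simp only [map_add, map_smul, LinearMap.add_apply, LinearMap.smul_apply, smul_eq_mul]
  rw [hs v u]
  ring

theorem bilinear_sq_le (hs : ∀ u v, B u v = B v u) (hp : ∀ u, 0 ≤ B u u) (u v : V) :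
    B u v ^ 2 ≤ B v v * B u u :=
  sq_le_mul_of_quadratic_nonneg fun t => by
    rw [← bilinear_add_smul hs]
    exact hp _

theorem bilinear_eq_zero (hs : ∀ u v, B u v = B v u) (hp : ∀ u, 0 ≤ B u u) {u : V}
    (hu : B u u = 0) (v : V) : B u v = 0 := by
  have := bilinear_sq_le hs hp u v
  rw [hu, mul_zero] at this
  exact pow_eq_zero_iff two_ne_zero |>.1 (le_antisymm this (sq_nonneg _))

end Bilinear

/-! ### Harmonic functions and traces of energy forms -/

section Form

variable {E : C(gasket, ℝ) → ℝ≥0∞}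

/-- The domain of an energy form. -/
def energyDomain (hE : IsNondegenerateEnergyForm E) : Submodule ℝ C(gasket, ℝ) where
  carrier := {u | E u < ∞}
  zero_mem' := by
    change E 0 < ∞
    rw [(hE.eq_zero_iff 0).2 ⟨0, fun _ => rfl⟩]
    exact ENNReal.zero_lt_top
  add_mem' := fun {u v} hu hv => by
    refine lt_of_le_of_lt (le_add_right le_rfl : E (u + v) ≤ E (u + v) + E (u - v)) ?_
    rw [hE.parallelogram]
    exact ENNReal.add_lt_top.2 ⟨ENNReal.mul_lt_top (by simp) hu, ENNReal.mul_lt_top (by simp) hv⟩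
  smul_mem' := fun t u hu => by
    change E (t • u) < ∞
    rw [hE.smul]
    exact ENNReal.mul_lt_top ENNReal.ofReal_lt_top hu

theorem exists_energy_bilinear (hE : IsNondegenerateEnergyForm E) :
    ∃ B : energyDomain hE →ₗ[ℝ] energyDomain hE →ₗ[ℝ] ℝ, (∀ u v, B u v = B v u) ∧
      ∀ u, B u u = (E (u : C(gasket, ℝ))).toReal := by
  refine exists_bilinear_of_parallelogram (fun u => ENNReal.toReal_nonneg) (fun t u => ?_)
    fun u v => ?_
  · rw [Submodule.coe_smul, hE.smul, ENNReal.toReal_mul, ENNReal.toReal_ofReal (sq_nonneg t)]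
  · have hu : E u < ∞ := u.2
    have hv : E v < ∞ := v.2
    have h1 : E ((u + v : energyDomain hE) : C(gasket, ℝ)) < ∞ := (u + v).2
    have h2 : E ((u - v : energyDomain hE) : C(gasket, ℝ)) < ∞ := (u - v).2
    rw [← ENNReal.toReal_add h1.ne h2.ne, Submodule.coe_add, Submodule.coe_sub, hE.parallelogram,
      ENNReal.toReal_add (ENNReal.mul_lt_top (by simp) hu).ne
        (ENNReal.mul_lt_top (by simp) hv).ne, ENNReal.toReal_mul, ENNReal.toReal_mul]
    simp

theorem const_mem_energyDomain (hE : IsNondegenerateEnergyForm E) (t : ℝ) :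
    ContinuousMap.const gasket t ∈ energyDomain hE := by
  change E _ < ∞
  rw [(hE.eq_zero_iff _).2 ⟨t, fun _ => rfl⟩]
  exact ENNReal.zero_lt_top

theorem exists_truncation (hE : IsNondegenerateEnergyForm E) (u : energyDomain hE) :
    ∃ v : energyDomain hE, (∀ x, (v : C(gasket, ℝ)) x = max 0 (min 1 ((u : C(gasket, ℝ)) x))) ∧
      E v ≤ E u := by
  let v : C(gasket, ℝ) := ⟨fun x => max 0 (min 1 ((u : C(gasket, ℝ)) x)), by fun_prop⟩
  have h := hE.markov u v fun _ => rfl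
  exact ⟨⟨v, h.trans_lt u.2⟩, fun _ => rfl, h⟩

theorem corner_injective : Function.Injective corner := by
  intro i j h
  by_contra hij
  have h0 := corner_re_im i
  have h1 := corner_re_im j
  rw [h] at h0
  have e1 := h0.1.symm.trans h1.1
  have e2 := h0.2.symm.trans h1.2
  have hi : i = 0 ∨ i = 1 ∨ i = 2 := by omega
  have hj : j = 0 ∨ j = 1 ∨ j = 2 := by omega
  rcases hi with rfl | rfl | rfl <;> rcases hj with rfl | rfl | rfl <;>
    simp at e1 e2 hij <;> linarith

theorem exists_separating (hE : IsNondegenerateEnergyForm E) {x y : gasket} (hxy : x ≠ y) :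
    ∃ u : energyDomain hE, (u : C(gasket, ℝ)) x = 1 ∧ (u : C(gasket, ℝ)) y = 0 ∧
      ∀ z, 0 ≤ (u : C(gasket, ℝ)) z ∧ (u : C(gasket, ℝ)) z ≤ 1 := by
  obtain ⟨w, hw, hne⟩ := hE.separates x y hxy
  have hne' : w x - w y ≠ 0 := sub_ne_zero.2 hne
  obtain ⟨u, hu, -⟩ := exists_truncation hE
    ((w x - w y)⁻¹ • ((⟨w, hw⟩ : energyDomain hE) -
      ⟨ContinuousMap.const gasket (w y), const_mem_energyDomain hE _⟩))
  refine ⟨u, ?_, ?_, fun z => ?_⟩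
  · rw [hu]
    simp [hne']
  · rw [hu]
    simp
  · rw [hu]
    exact ⟨le_max_left _ _, max_le zero_le_one (min_le_left _ _)⟩

/-- For `f`, `g` with values in `[0, 1]`, the function `f - max 0 (min 1 (f - g))` is the minimum of
`f` and `g`. So truncation alone gives a minimum of functions that each vanish at one of the other
vertices. -/
theorem exists_boundaryValues_single (hE : IsNondegenerateEnergyForm E) (j : Fin 3) :
    ∃ u : energyDomain hE, boundaryValues (u : C(gasket, ℝ)) = Pi.single j 1 := by
  have hk : j ≠ j + 1 := by revert j; decide
  have hl : j ≠ j + 2 := by revert j; decide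
  obtain ⟨f, f1, f0, hf⟩ := exists_separating hE (corner_injective.ne hk)
  obtain ⟨g, g1, g0, hg⟩ := exists_separating hE (corner_injective.ne hl)
  obtain ⟨v, hv, -⟩ := exists_truncation hE (f - g)
  refine ⟨f - v, funext fun i => ?_⟩
  have e : boundaryValues ((f - v : energyDomain hE) : C(gasket, ℝ)) i =
      (f : C(gasket, ℝ)) (corner i) - max 0 (min 1 ((f : C(gasket, ℝ)) (corner i) -
        (g : C(gasket, ℝ)) (corner i))) := by
    rw [← ContinuousMap.sub_apply, ← Submodule.coe_sub, ← hv]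
    rfl
  rw [e]
  have hi : i = j ∨ i = j + 1 ∨ i = j + 2 := by
    clear * -
    revert i j
    decide
  rcases hi with rfl | rfl | rfl
  · rw [f1, g1, Pi.single_eq_same]
    simp
  · rw [f0, Pi.single_eq_of_ne hk.symm]
    have := (hg (corner (j + 1))).1
    rw [max_eq_left ((min_le_right _ _).trans (by linarith))]
    simp
  · rw [g0, Pi.single_eq_of_ne hl.symm, sub_zero, min_eq_right (hf _).2, max_eq_right (hf _).1]
    simp

/-- A function of minimal energy among those with the same values at the vertices. -/
theorem exists_harmonic (hE : IsNondegenerateEnergyForm E)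
    {B : energyDomain hE →ₗ[ℝ] energyDomain hE →ₗ[ℝ] ℝ} (hs : ∀ u v, B u v = B v u)
    (hB : ∀ u, B u u = (E (u : C(gasket, ℝ))).toReal) (u₀ : energyDomain hE) :
    ∃ h : energyDomain hE, boundaryValues (h : C(gasket, ℝ)) =
      boundaryValues (u₀ : C(gasket, ℝ)) ∧
      ∀ w : energyDomain hE, boundaryValues (w : C(gasket, ℝ)) = 0 → B h w = 0 := by
  have hp : ∀ u, 0 ≤ B u u := fun u => by rw [hB]; exact ENNReal.toReal_nonneg
  let S : Set ℝ := (fun u : energyDomain hE => B u u) ''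
    {u | boundaryValues (u : C(gasket, ℝ)) = boundaryValues (u₀ : C(gasket, ℝ))}
  have hSb : BddBelow S := ⟨0, by rintro _ ⟨u, -, rfl⟩; exact hp u⟩
  have hSn : S.Nonempty := ⟨_, u₀, rfl, rfl⟩
  have hseq : ∀ n : ℕ, ∃ u : energyDomain hE, boundaryValues (u : C(gasket, ℝ)) =
      boundaryValues (u₀ : C(gasket, ℝ)) ∧ B u u < sInf S + 1 / (n + 1 : ℝ) := fun n => by
    obtain ⟨_, ⟨u, hu, rfl⟩, hlt⟩ := exists_lt_of_csInf_lt hSn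
      (lt_add_of_pos_right (sInf S) (Nat.one_div_pos_of_nat (n := n) (α := ℝ)))
    exact ⟨u, hu, hlt⟩
  choose u hub huE using hseq
  have hinf : ∀ v : energyDomain hE, boundaryValues (v : C(gasket, ℝ)) =
      boundaryValues (u₀ : C(gasket, ℝ)) → sInf S ≤ B v v := fun v hv =>
    csInf_le hSb ⟨v, hv, rfl⟩
  -- The midpoint is admissible, so its energy is at least the infimum; the parallelogram law then
  -- bounds the difference.
  have hsub : ∀ m n, B (u m - u n) (u m - u n) ≤ 2 * (1 / (m + 1 : ℝ)) + 2 * (1 / (n + 1 : ℝ)) := by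
    intro m n
    have h1 := hinf ((1 / 2 : ℝ) • (u m + u n)) (funext fun j => by
      have e1 := congrFun (hub m) j
      have e2 := congrFun (hub n) j
      simp only [boundaryValues] at e1 e2 ⊢
      simp only [Submodule.coe_smul, Submodule.coe_add, ContinuousMap.smul_apply,
        ContinuousMap.add_apply, smul_eq_mul, e1, e2]
      ring)
    have h2 := huE m
    have h3 := huE n
    simp only [map_add, map_sub, map_smul, LinearMap.add_apply, LinearMap.sub_apply,
      LinearMap.smul_apply, smul_eq_mul] at h1 ⊢
    rw [hs (u n) (u m)] at h1 ⊢
    linarith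
  have hlim := tendsto_one_div_add_atTop_nhds_zero_nat (𝕜 := ℝ)
  obtain ⟨v, hvE, hv⟩ := hE.complete (fun n => u n) (fun n => (u n).2) (by
    intro ε hε
    obtain ⟨δ, hδ, hδε⟩ := ENNReal.lt_iff_exists_real_btwn.1 hε
    have hδ' : 0 < δ := ENNReal.ofReal_pos.1 hδε.1
    obtain ⟨N, hN⟩ := (hlim.eventually (gt_mem_nhds (show 0 < δ / 4 by positivity))).exists_forall_of_atTop
    refine ⟨N, fun m hm n hn => lt_of_le_of_lt ?_ hδε.2⟩
    have h1 := hsub m n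
    rw [hB] at h1
    have h2 := hN m hm
    have h3 := hN n hn
    have hfin : E ((u m - u n : energyDomain hE) : C(gasket, ℝ)) < ∞ := (u m - u n).2
    change E ((u m - u n : energyDomain hE) : C(gasket, ℝ)) ≤ _
    rw [ENNReal.le_ofReal_iff_toReal_le hfin.ne hδ]
    linarith)
  let v' : energyDomain hE := ⟨v, hvE⟩
  have hv' : Filter.Tendsto (fun n => B (u n - v') (u n - v')) Filter.atTop (𝓝 0) := by
    have := (ENNReal.tendsto_toReal ENNReal.zero_ne_top).comp hv
    refine (this.congr fun n => ?_)
    rw [hB]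
    rfl
  -- Convergence in energy controls values only up to constants. The finite resistances transfer the
  -- differences, and the constant `k` below restores the values.
  have hdiff : ∀ j, v (corner j) - v (corner 0) =
      (u₀ : C(gasket, ℝ)) (corner j) - (u₀ : C(gasket, ℝ)) (corner 0) := by
    intro j
    obtain ⟨C, hC⟩ := hE.resistance_lt (corner j) (corner 0)
    have h1 : Filter.Tendsto (fun n => C * B (u n - v') (u n - v')) Filter.atTop (𝓝 0) := by
      simpa using hv'.const_mul C
    have h2 := ge_of_tendsto' h1 fun n => by
      have h3 := hC _ (u n - v').2
      rw [← hB] at h3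
      have e1 := congrFun (hub n) j
      have e2 := congrFun (hub n) 0
      simp only [boundaryValues] at e1 e2
      rw [Submodule.coe_sub, ContinuousMap.sub_apply, ContinuousMap.sub_apply, e1, e2] at h3
      exact h3
    have h4 := pow_eq_zero_iff two_ne_zero |>.1 (le_antisymm h2 (sq_nonneg _))
    simp only [v'] at h4
    linarith
  let k : energyDomain hE := ⟨ContinuousMap.const gasket
    ((u₀ : C(gasket, ℝ)) (corner 0) - v (corner 0)), const_mem_energyDomain hE _⟩
  have hk : B k k = 0 := by
    rw [hB, (hE.eq_zero_iff _).2 ⟨_, fun _ => rfl⟩]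
    rfl
  refine ⟨v' + k, funext fun j => ?_, fun w hw => ?_⟩
  · have := hdiff j
    change v (corner j) + ((u₀ : C(gasket, ℝ)) (corner 0) - v (corner 0)) =
      (u₀ : C(gasket, ℝ)) (corner j)
    linarith
  · rw [map_add, LinearMap.add_apply, bilinear_eq_zero hs hp hk, add_zero]
    -- Near-minimality of `u n` along the line `u n + t • w` bounds the cross term through the
    -- discriminant.
    have h1 : ∀ n : ℕ, B (u n) w ^ 2 ≤ B w w * (1 / (n + 1 : ℝ)) := fun n => by
      refine sq_le_mul_of_quadratic_nonneg fun t => ?_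
      have h2 := hinf (u n + t • w) (funext fun j => by
        have e1 := congrFun (hub n) j
        have e2 := congrFun hw j
        simp only [boundaryValues, Pi.zero_apply] at e1 e2 ⊢
        simp [e1, e2])
      rw [bilinear_add_smul hs] at h2
      linarith [huE n]
    have h3 : ∀ n : ℕ, B v' w ^ 2 ≤ 2 * (B w w * (1 / (n + 1 : ℝ))) +
        2 * (B w w * B (u n - v') (u n - v')) := fun n => by
      have h4 := bilinear_sq_le hs hp (u n - v') w
      have h5 : B v' w = B (u n) w - B (u n - v') w := by
        rw [map_sub, LinearMap.sub_apply]
        ring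
      rw [h5]
      nlinarith [h1 n, sq_nonneg (B (u n) w + B (u n - v') w)]
    have h6 : Filter.Tendsto (fun n : ℕ => 2 * (B w w * (1 / (n + 1 : ℝ))) +
        2 * (B w w * B (u n - v') (u n - v'))) Filter.atTop (𝓝 0) := by
      simpa using ((hlim.const_mul (B w w)).const_mul 2).add ((hv'.const_mul (B w w)).const_mul 2)
    exact pow_eq_zero_iff two_ne_zero |>.1
      (le_antisymm (ge_of_tendsto' h6 h3) (sq_nonneg _))

/-- The conductances `c` and the harmonic functions `H` describe the trace of `E` on the vertices. -/
structure IsTrace (E : C(gasket, ℝ) → ℝ≥0∞) (c : Fin 3 → ℝ) (H : (Fin 3 → ℝ) → C(gasket, ℝ)) :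
    Prop where
  nonneg : ∀ i, 0 ≤ c i
  pos : 0 < c 1 * c 2 + c 0 * c 2 + c 0 * c 1
  boundary : ∀ a, boundaryValues (H a) = a
  energy : ∀ a, E (H a) = ENNReal.ofReal (triangleForm c a)
  split : ∀ u, E u = E (H (boundaryValues u)) + E (u - H (boundaryValues u))
  add_const : ∀ u v t, (∀ x, v x = u x + t) → E v = E u

/-- The trace of an energy form on the vertices is the form of a triangle, and functions split
orthogonally into a harmonic part and a part that vanishes at the vertices. -/
theorem exists_trace (hE : IsNondegenerateEnergyForm E) : ∃ c H, IsTrace E c H := by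
  obtain ⟨B, hs, hB⟩ := exists_energy_bilinear hE
  have hp : ∀ u, 0 ≤ B u u := fun u => by rw [hB]; exact ENNReal.toReal_nonneg
  have hη : ∀ j, ∃ h : energyDomain hE, boundaryValues (h : C(gasket, ℝ)) = Pi.single j 1 ∧
      ∀ w : energyDomain hE, boundaryValues (w : C(gasket, ℝ)) = 0 → B h w = 0 := fun j => by
    obtain ⟨u, hu⟩ := exists_boundaryValues_single hE j
    obtain ⟨h, h1, h2⟩ := exists_harmonic hE hs hB u
    exact ⟨h, h1.trans hu, h2⟩
  choose η hηb hηo using hη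
  have hηx : ∀ j k, (η j : C(gasket, ℝ)) (corner k) = (Pi.single j 1 : Fin 3 → ℝ) k := fun j k =>
    congrFun (hηb j) k
  let H : (Fin 3 → ℝ) → energyDomain hE := fun a => a 0 • η 0 + a 1 • η 1 + a 2 • η 2
  have hHb : ∀ a, boundaryValues (H a : C(gasket, ℝ)) = a := by
    intro a
    ext k
    have e : boundaryValues (H a : C(gasket, ℝ)) k = a 0 * (η 0 : C(gasket, ℝ)) (corner k) +
      a 1 * (η 1 : C(gasket, ℝ)) (corner k) + a 2 * (η 2 : C(gasket, ℝ)) (corner k) := rfl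
    rw [e, hηx, hηx, hηx]
    have hk : k = 0 ∨ k = 1 ∨ k = 2 := by omega
    rcases hk with rfl | rfl | rfl <;> simp
  have hHo : ∀ a (w : energyDomain hE), boundaryValues (w : C(gasket, ℝ)) = 0 → B (H a) w = 0 := by
    intro a w hw
    simp only [H, map_add, map_smul, LinearMap.add_apply, LinearMap.smul_apply, hηo _ w hw]
    simp
  let k : ℝ → energyDomain hE := fun t => ⟨ContinuousMap.const gasket t, const_mem_energyDomain hE _⟩
  have hk : ∀ t v, B (k t) v = 0 := fun t v => bilinear_eq_zero hs hp (by
    rw [hB, (hE.eq_zero_iff _).2 ⟨t, fun _ => rfl⟩]; rfl) v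
  -- `H 1` and the constant 1 have the same vertex values, so `η j` is orthogonal to their
  -- difference, and it is orthogonal to constants.
  have hsum : ∀ j, B (η j) (η 0) + B (η j) (η 1) + B (η j) (η 2) = 0 := by
    intro j
    have h1 := hηo j (H 1 - k 1) (by
      have h2 := hHb 1
      ext i
      have h3 := congrFun h2 i
      change boundaryValues (H 1 : C(gasket, ℝ)) i - 1 = 0
      rw [h3]
      simp)
    rw [map_sub, hs _ (k 1), hk, sub_zero] at h1
    simpa [H] using h1
  -- The Markov property: truncating `η i - ε • η j` restores the vertex values of `η i`, so it
  -- cannot have less energy than `η i`. Comparison to first order in `ε` gives the sign.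
  have hneg : ∀ i j, i ≠ j → B (η i) (η j) ≤ 0 := by
    intro i j hij
    have key : ∀ ε : ℝ, 0 < ε → 2 * B (η i) (η j) ≤ ε * B (η j) (η j) := by
      intro ε hε
      obtain ⟨v, hv, hvE⟩ := exists_truncation hE (η i + (-ε) • η j)
      have h1 : B v v ≤ B (η i + (-ε) • η j) (η i + (-ε) • η j) := by
        rw [hB, hB]
        exact ENNReal.toReal_mono (η i + (-ε) • η j).2.ne hvE
      have hvb : boundaryValues ((v - η i : energyDomain hE) : C(gasket, ℝ)) = 0 := by
        ext l
        change (v : C(gasket, ℝ)) (corner l) - (η i : C(gasket, ℝ)) (corner l) = 0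
        rw [hv]
        change max 0 (min 1 ((η i : C(gasket, ℝ)) (corner l) +
          (-ε) * (η j : C(gasket, ℝ)) (corner l))) - (η i : C(gasket, ℝ)) (corner l) = 0
        rw [hηx, hηx]
        by_cases hli : l = i
        · subst hli
          rw [Pi.single_eq_same, Pi.single_eq_of_ne hij]
          simp
        · rw [Pi.single_eq_of_ne hli]
          by_cases hlj : l = j
          · subst hlj
            rw [Pi.single_eq_same]
            simp [hε.le]
          · rw [Pi.single_eq_of_ne hlj]
            simp
      have h2 := hηo i _ hvb
      have h3 := hp (v - η i)
      rw [map_sub] at h2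
      have h4 : B (v - η i) (v - η i) = B v v - 2 * B (η i) v + B (η i) (η i) := by
        simp only [map_sub, LinearMap.sub_apply, hs v (η i)]
        ring
      rw [bilinear_add_smul hs] at h1
      nlinarith
    by_contra! hcon
    have h0 := hp (η j)
    have h1 := key (B (η i) (η j) / (B (η j) (η j) + 1)) (by positivity)
    have h2 : B (η i) (η j) / (B (η j) (η j) + 1) * B (η j) (η j) ≤ B (η i) (η j) := by
      rw [div_mul_eq_mul_div, div_le_iff₀ (by positivity)]
      nlinarith
    linarith
  have hpos : ∀ j, 0 < B (η j) (η j) := by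
    intro j
    refine lt_of_le_of_ne (hp _) fun h => ?_
    rw [hB] at h
    have h1 : E (η j) = 0 := by
      rcases (ENNReal.toReal_eq_zero_iff _).1 h.symm with h | h
      · exact h
      · exact absurd h (η j).2.ne
    obtain ⟨t, ht⟩ := (hE.eq_zero_iff _).1 h1
    have h2 := hηx j j
    have h3 := hηx j (j + 1)
    rw [ht, Pi.single_eq_same] at h2
    rw [ht, Pi.single_eq_of_ne (by clear * -; revert j; decide)] at h3
    linarith
  let c : Fin 3 → ℝ := ![-B (η 1) (η 2), -B (η 0) (η 2), -B (η 0) (η 1)]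
  have hc : ∀ i, 0 ≤ c i := by
    have h0 := hneg 1 2 (by decide)
    have h1 := hneg 0 2 (by decide)
    have h2 := hneg 0 1 (by decide)
    intro i
    fin_cases i <;> simp [c, h0, h1, h2]
  -- The energy of `η j` is the sum of the two conductances at vertex `j`, so at most one
  -- conductance vanishes.
  have hcD : 0 < c 1 * c 2 + c 0 * c 2 + c 0 * c 1 := by
    have s0 := hsum 0
    have s1 := hsum 1
    have s2 := hsum 2
    have p0 := hpos 0
    have p1 := hpos 1
    have p2 := hpos 2
    rw [hs (η 1) (η 0)] at s1
    rw [hs (η 2) (η 0), hs (η 2) (η 1)] at s2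
    have e0 : c 0 = -B (η 1) (η 2) := rfl
    have e1 : c 1 = -B (η 0) (η 2) := rfl
    have e2 : c 2 = -B (η 0) (η 1) := rfl
    have c0 := hc 0
    have c1 := hc 1
    have c2 := hc 2
    rcases c0.eq_or_lt with h | h
    · have h1 : 0 < c 1 := by linarith
      have h2 : 0 < c 2 := by linarith
      positivity
    · have h12 : 0 < c 0 * (c 1 + c 2) := mul_pos h (by linarith)
      have := mul_nonneg c1 c2
      linarith
  have hE_eq : ∀ u : energyDomain hE, E u = ENNReal.ofReal (B u u) := fun u => by
    have : E u < ∞ := u.2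
    rw [hB, ENNReal.ofReal_toReal this.ne]
  refine ⟨c, fun a => H a, hc, hcD, hHb, fun a => ?_, fun u => ?_, fun u v t h => ?_⟩
  · rw [hE_eq]
    congr 1
    have s0 := hsum 0
    have s1 := hsum 1
    have s2 := hsum 2
    rw [hs (η 1) (η 0)] at s1
    rw [hs (η 2) (η 0), hs (η 2) (η 1)] at s2
    have e0 : c 0 = -B (η 1) (η 2) := rfl
    have e1 : c 1 = -B (η 0) (η 2) := rfl
    have e2 : c 2 = -B (η 0) (η 1) := rfl
    simp only [H, triangleForm, e0, e1, e2, map_add, map_smul, LinearMap.add_apply,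
      LinearMap.smul_apply, smul_eq_mul]
    rw [hs (η 1) (η 0), hs (η 2) (η 0), hs (η 2) (η 1)]
    linear_combination a 0 ^ 2 * s0 + a 1 ^ 2 * s1 + a 2 ^ 2 * s2
  · by_cases hu : E u < ∞
    · let u' : energyDomain hE := ⟨u, hu⟩
      have h1 := hHo (boundaryValues u) (u' - H (boundaryValues u)) (by
        ext j
        have := congrFun (hHb (boundaryValues u)) j
        change boundaryValues u j - boundaryValues (H (boundaryValues u) : C(gasket, ℝ)) j = 0
        rw [this, sub_self])
      have h2 : E u = ENNReal.ofReal (B u' u') := hE_eq u'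
      have h3 : E (u - H (boundaryValues u)) = ENNReal.ofReal
        (B (u' - H (boundaryValues u)) (u' - H (boundaryValues u))) :=
        hE_eq (u' - H (boundaryValues u))
      rw [h2, h3, hE_eq, ← ENNReal.ofReal_add (hp _) (hp _)]
      congr 1
      set h' := H (boundaryValues u)
      rw [map_sub] at h1
      simp only [map_sub, LinearMap.sub_apply, hs u' h']
      linarith
    · have h1 : E (u - H (boundaryValues u)) = ∞ := by
        by_contra h
        refine hu ?_
        have h2 : u - H (boundaryValues u) ∈ energyDomain hE := lt_top_iff_ne_top.2 h
        have h3 := (energyDomain hE).add_mem h2 (H (boundaryValues u)).2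
        rwa [sub_add_cancel] at h3
      rw [h1, add_top]
      simpa using hu
  · have hv : v = u + (k t : C(gasket, ℝ)) := ContinuousMap.ext h
    by_cases hu : E u < ∞
    · obtain ⟨u', rfl⟩ : ∃ u' : energyDomain hE, (u' : C(gasket, ℝ)) = u := ⟨⟨u, hu⟩, rfl⟩
      rw [hv, ← Submodule.coe_add, hE_eq, hE_eq]
      congr 1
      simp only [map_add, LinearMap.add_apply, hk, hs u' (k t), add_zero]
    · have h1 : ¬ E v < ∞ := fun h2 => hu (by
        have h3 := (energyDomain hE).sub_mem (show v ∈ energyDomain hE from h2) (k t).2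
        rwa [hv, add_sub_cancel_right] at h3)
      rw [not_lt_top_iff] at hu h1
      rw [hu, h1]

end Form

/-! ### The eigenvalue problem for the trace -/

/-- There is a minimum at `t = 0`, so the derivative `2 * b` vanishes. This serves to differentiate
the renormalization gap at its zeros. -/
theorem eq_zero_of_quadratic_nonneg {a b : ℝ} (h : ∀ t : ℝ, 0 ≤ a * t ^ 2 + 2 * b * t) : b = 0 := by
  have := sq_le_mul_of_quadratic_nonneg (a := a) (b := b) (c := 0) fun t => by linarith [h t]
  rw [mul_zero] at this
  exact pow_eq_zero_iff two_ne_zero |>.1 (le_antisymm this (sq_nonneg _))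

/-- Potential differences in a triangle in terms of the currents: the equivalent star has the
resistances `c i * d`. -/
theorem triangle_potential {c0 c1 c2 x0 x1 x2 d : ℝ}
    (hd : d * (c1 * c2 + c0 * c2 + c0 * c1) = 1) (h0 : x0 = c0 * d) (h1 : x1 = c1 * d)
    (h2 : x2 = c2 * d) (a b e : ℝ) :
    a - b = x0 * (c2 * (a - b) + c1 * (a - e)) - x1 * (c2 * (b - a) + c0 * (b - e)) ∧
    a - e = x0 * (c2 * (a - b) + c1 * (a - e)) - x2 * (c1 * (e - a) + c0 * (e - b)) ∧
    b - e = x1 * (c2 * (b - a) + c0 * (b - e)) - x2 * (c1 * (e - a) + c0 * (e - b)) := by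
  subst h0 h1 h2
  exact ⟨by linear_combination (b - a) * hd, by linear_combination (e - a) * hd,
    by linear_combination (e - b) * hd⟩

/-- The energy of values `a` at the vertices and `u, v, w` at the junction points, minus the energy
of `a`; here `k i` is the reciprocal weight of cell `i`. -/
def renormalizationGap (c0 c1 c2 k0 k1 k2 a0 a1 a2 u v w : ℝ) : ℝ :=
  k0 * (c0 * (u - v) ^ 2 + c1 * (a0 - v) ^ 2 + c2 * (a0 - u) ^ 2) +
  k1 * (c0 * (u - a1) ^ 2 + c1 * (w - a1) ^ 2 + c2 * (w - u) ^ 2) +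
  k2 * (c0 * (a2 - v) ^ 2 + c1 * (w - v) ^ 2 + c2 * (w - a2) ^ 2) -
  (c0 * (a1 - a2) ^ 2 + c1 * (a0 - a2) ^ 2 + c2 * (a0 - a1) ^ 2)

/-- If the trace of the renormalized energy is the energy itself, then for given currents
`f` at the vertices there are currents `p, q` leaving cell `0` through its two junction points that
satisfy the conservation and potential laws. -/
theorem exists_currents {c0 c1 c2 k0 k1 k2 s0 s1 s2 x0 x1 x2 d : ℝ}
    (hd : d * (c1 * c2 + c0 * c2 + c0 * c1) = 1) (h0 : x0 = c0 * d) (h1 : x1 = c1 * d)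
    (h2 : x2 = c2 * d)
    (hk0 : s0 * k0 = 1) (hk1 : s1 * k1 = 1) (hk2 : s2 * k2 = 1)
    (hle : ∀ a0 a1 a2 u v w, 0 ≤ renormalizationGap c0 c1 c2 k0 k1 k2 a0 a1 a2 u v w)
    (heq : ∀ a0 a1 a2, ∃ u v w, renormalizationGap c0 c1 c2 k0 k1 k2 a0 a1 a2 u v w = 0)
    {f0 f1 f2 : ℝ} (hf : f0 + f1 + f2 = 0) :
    ∃ p q, p + q = -f0 ∧
      s1 * (x0 * (p - f1) + x1 * p) + s0 * (x1 * p - x2 * q) + s2 * (x0 * (p - f1) - x2 * q) = 0 ∧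
      x0 * f0 - x1 * f1 = s0 * (x0 * f0 - x1 * p) - s1 * (x1 * p + x2 * f1) ∧
      x0 * f0 - x2 * f2 = s0 * (x0 * f0 - x2 * q) - s2 * (x1 * f2 + x2 * q) := by
  -- These are the vertex potentials of the equivalent star with its centre at potential 0 and the
  -- currents `f` through its arms.
  obtain ⟨u, v, w, hE⟩ := heq (x0 * f0) (x1 * f1) (x2 * f2)
  set a0 := x0 * f0 with ha0
  set a1 := x1 * f1 with ha1
  set a2 := x2 * f2 with ha2
  -- The gap is nonnegative in all six variables and zero here, so its partial derivatives vanish.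
  -- `D1` to `D3` match the cell currents at the vertices with those of the outer triangle; `D4` and
  -- `D5` are current conservation at the junctions `u` and `v`.
  have D1 : k0 * (c1 * (a0 - v) + c2 * (a0 - u)) - (c1 * (a0 - a2) + c2 * (a0 - a1)) = 0 :=
    eq_zero_of_quadratic_nonneg (a := k0 * (c1 + c2) - (c1 + c2)) fun t => by
      have h := hle (a0 + t) a1 a2 u v w
      simp only [renormalizationGap] at h hE
      linarith
  have D2 : k1 * (c0 * (a1 - u) + c1 * (a1 - w)) - (c0 * (a1 - a2) + c2 * (a1 - a0)) = 0 :=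
    eq_zero_of_quadratic_nonneg (a := k1 * (c0 + c1) - (c0 + c2)) fun t => by
      have h := hle a0 (a1 + t) a2 u v w
      simp only [renormalizationGap] at h hE
      linarith
  have D3 : k2 * (c0 * (a2 - v) + c2 * (a2 - w)) - (c0 * (a2 - a1) + c1 * (a2 - a0)) = 0 :=
    eq_zero_of_quadratic_nonneg (a := k2 * (c0 + c2) - (c0 + c1)) fun t => by
      have h := hle a0 a1 (a2 + t) u v w
      simp only [renormalizationGap] at h hE
      linarith
  have D4 : k0 * (c0 * (u - v) + c2 * (u - a0)) + k1 * (c0 * (u - a1) + c2 * (u - w)) = 0 :=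
    eq_zero_of_quadratic_nonneg (a := k0 * (c0 + c2) + k1 * (c0 + c2)) fun t => by
      have h := hle a0 a1 a2 (u + t) v w
      simp only [renormalizationGap] at h hE
      linarith
  have D5 : k0 * (c0 * (v - u) + c1 * (v - a0)) + k2 * (c0 * (v - a2) + c1 * (v - w)) = 0 :=
    eq_zero_of_quadratic_nonneg (a := k0 * (c0 + c1) + k2 * (c0 + c1)) fun t => by
      have h := hle a0 a1 a2 u (v + t) w
      simp only [renormalizationGap] at h hE
      linarith
  obtain ⟨P1, P2, P3⟩ := triangle_potential hd h0 h1 h2 a0 u v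
  obtain ⟨P4, -, P5⟩ := triangle_potential hd h0 h1 h2 w u a1
  obtain ⟨-, P6, P7⟩ := triangle_potential hd h0 h1 h2 w a2 v
  have hx : c1 * x2 = c2 * x1 ∧ c0 * x2 = c2 * x0 ∧ c0 * x1 = c1 * x0 ∧
      c2 * x0 + c1 * x0 + c2 * x1 = 1 := by
    rw [h0, h1, h2]
    exact ⟨by ring, by ring, by ring, by linear_combination hd⟩
  obtain ⟨e1, e2, e3, e4⟩ := hx
  have F0 : c1 * (a0 - a2) + c2 * (a0 - a1) = f0 := by
    rw [ha0, ha1, ha2]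
    linear_combination (-f2) * e1 + f0 * e4 - c2 * x1 * hf
  have F1 : c0 * (a1 - a2) + c2 * (a1 - a0) = f1 := by
    rw [ha0, ha1, ha2]
    linear_combination (-f2) * e2 + f1 * e3 + f1 * e4 - c2 * x0 * hf
  have F2 : c0 * (a2 - a1) + c1 * (a2 - a0) = f2 := by
    linear_combination -F0 - F1 - hf
  rw [F0] at D1
  rw [F1] at D2
  rw [F2] at D3
  set p := k0 * (c2 * (u - a0) + c0 * (u - v)) with hp
  set q := k0 * (c1 * (v - a0) + c0 * (v - u)) with hq
  have G0 : c2 * (a0 - u) + c1 * (a0 - v) = s0 * f0 := by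
    linear_combination s0 * D1 - (c2 * (a0 - u) + c1 * (a0 - v)) * hk0
  have Gp : c2 * (u - a0) + c0 * (u - v) = s0 * p := by
    rw [hp]; linear_combination -(c2 * (u - a0) + c0 * (u - v)) * hk0
  have Gq : c1 * (v - a0) + c0 * (v - u) = s0 * q := by
    rw [hq]; linear_combination -(c1 * (v - a0) + c0 * (v - u)) * hk0
  have G1 : c1 * (a1 - w) + c0 * (a1 - u) = s1 * f1 := by
    linear_combination s1 * D2 - (c1 * (a1 - w) + c0 * (a1 - u)) * hk1
  have Gp' : c2 * (u - w) + c0 * (u - a1) = -(s1 * p) := by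
    rw [hp]; linear_combination s1 * D4 - (c2 * (u - w) + c0 * (u - a1)) * hk1
  have Gg : c2 * (w - u) + c1 * (w - a1) = s1 * (p - f1) := by
    linear_combination -G1 - Gp'
  have G2 : c2 * (a2 - w) + c0 * (a2 - v) = s2 * f2 := by
    linear_combination s2 * D3 - (c2 * (a2 - w) + c0 * (a2 - v)) * hk2
  have Gq' : c1 * (v - w) + c0 * (v - a2) = -(s2 * q) := by
    rw [hq]; linear_combination s2 * D5 - (c1 * (v - w) + c0 * (v - a2)) * hk2
  have hpq : p + q = -f0 := by
    rw [hp, hq]; linear_combination -D1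
  have Gg' : c2 * (w - a2) + c1 * (w - v) = -(s2 * (p - f1)) := by
    linear_combination -G2 - Gq' + s2 * hpq - s2 * hf
  rw [G0, Gp] at P1
  rw [G0, Gq] at P2
  rw [Gp, Gq] at P3
  rw [Gg, Gp'] at P4
  rw [Gp', G1] at P5
  rw [Gg', Gq'] at P6
  rw [G2, Gq'] at P7
  -- The first law closes the loop through `u`, `w`, `v`. The other two follow the potential from
  -- vertex 0 to vertices 1 and 2, through `u` and `v` respectively.
  refine ⟨p, q, hpq, ?_, ?_, ?_⟩
  · linear_combination P6 - P4 - P3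
  · linear_combination P1 + P5
  · linear_combination P2 - P7

/-- The fixed points of the renormalization with two equal weights. -/
theorem eigenform_of_gap {c0 c1 c2 s0 s : ℝ} (h0 : 0 ≤ c0) (h1 : 0 ≤ c1) (h2 : 0 ≤ c2)
    (hD : 0 < c1 * c2 + c0 * c2 + c0 * c1) (hs0 : 0 < s0) (hs : 0 < s)
    (hle : ∀ a0 a1 a2 u v w, 0 ≤ renormalizationGap c0 c1 c2 s0⁻¹ s⁻¹ s⁻¹ a0 a1 a2 u v w)
    (heq : ∀ a0 a1 a2, ∃ u v w, renormalizationGap c0 c1 c2 s0⁻¹ s⁻¹ s⁻¹ a0 a1 a2 u v w = 0) :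
    ∃ x, 0 < x ∧ 0 < c1 ∧ c0 = x * c1 ∧ c2 = c1 ∧
      4 * x ^ 2 + 2 * (1 - s0 / s) * (1 + s0 / s) * x - (1 + s0 / s) ^ 2 = 0 ∧
      s⁻¹ = s0 / s + 2 / (2 * x + 1) := by
  set D := c1 * c2 + c0 * c2 + c0 * c1 with hDdef
  obtain ⟨x0, hx0⟩ : ∃ x0, x0 = c0 / D := ⟨_, rfl⟩
  obtain ⟨x1, hx1⟩ : ∃ x1, x1 = c1 / D := ⟨_, rfl⟩
  obtain ⟨x2, hx2⟩ : ∃ x2, x2 = c2 / D := ⟨_, rfl⟩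
  have hx0' : 0 ≤ x0 := by rw [hx0]; positivity
  have hx1' : 0 ≤ x1 := by rw [hx1]; positivity
  have hx2' : 0 ≤ x2 := by rw [hx2]; positivity
  have h12 : 0 < x1 + x2 := by
    rw [hx1, hx2, ← add_div]
    refine div_pos ?_ hD
    by_contra! hcon
    have e1 : c1 = 0 := by linarith
    have e2 : c2 = 0 := by linarith
    rw [hDdef, e1, e2] at hD
    simp at hD
  have cur := fun f0 f1 f2 => exists_currents (f0 := f0) (f1 := f1) (f2 := f2)
    (inv_mul_cancel₀ hD.ne') (hx0.trans (div_eq_mul_inv _ _)) (hx1.trans (div_eq_mul_inv _ _))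
    (hx2.trans (div_eq_mul_inv _ _))
    (mul_inv_cancel₀ hs0.ne') (mul_inv_cancel₀ hs.ne') (mul_inv_cancel₀ hs.ne') hle heq
  -- For a unit current between vertices 1 and 2, the difference `A3 - A2` determines `p` and the
  -- sum then forces `x1 = x2`, so the symmetry of the trace is a consequence. The pattern between
  -- vertices 0 and 2 supplies the second relation `I2`.
  obtain ⟨p, q, hpq, A1, A2, A3⟩ := cur 0 1 (-1) (by norm_num)
  obtain ⟨p', q', hpq', B1, B2, -⟩ := cur 1 0 (-1) (by norm_num)
  have hq : q = -p := by linarith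
  subst hq
  have hsum : (x1 + x2) * (1 - (s0 + s) * p - s) = 0 := by linear_combination A3 - A2
  have hp : (s0 + s) * p = 1 - s := by
    have := (mul_eq_zero.1 hsum).resolve_left h12.ne'
    linarith
  have hdiff : (x1 - x2) * (2 * s) = 0 := by
    linear_combination -A2 - A3 + (x1 - x2) * hp
  have hxy : x2 = x1 := by
    have := (mul_eq_zero.1 hdiff).resolve_right (by positivity)
    linarith
  subst hxy
  have hy : 0 < x2 := by linarith
  have I1 : ((s0 + s) * x2 + s * x0) * (1 - s) = s * x0 * (s0 + s) := by
    linear_combination (s0 + s) / 2 * A1 - ((s0 + s) * x2 + s * x0) * hp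
  have hq' : q' = -1 - p' := by linarith
  subst hq'
  have I2 : 2 * ((s0 + s) * x2 + s * x0) * (1 - s0) * x0 = (s0 + s) ^ 2 * x2 ^ 2 := by
    linear_combination 2 * ((s0 + s) * x2 + s * x0) * B2 - (s0 + s) * x2 * B1
  have hx0pos : 0 < x0 := by
    refine lt_of_le_of_ne hx0' fun h => ?_
    rw [← h] at I2
    have : 0 < (s0 + s) ^ 2 * x2 ^ 2 := by positivity
    linarith
  have hsne := hs.ne'
  have hyne := hy.ne'
  set r := s0 / s with hr
  have hs0r : s0 = r * s := by rw [hr]; field_simp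
  have hr0 : 0 < r := by positivity
  obtain ⟨x, hx⟩ : ∃ x, x = x0 / x2 := ⟨_, rfl⟩
  have hxx : x0 = x * x2 := by rw [hx]; field_simp
  have hxpos : 0 < x := by rw [hx]; positivity
  obtain ⟨L, hL⟩ : ∃ L, L = s⁻¹ := ⟨_, rfl⟩
  have hLs : L * s = 1 := by rw [hL]; exact inv_mul_cancel₀ hsne
  -- In the scale-free unknowns `r`, `x` and `L` both relations are linear in `L`; eliminating `L`
  -- leaves the quadratic for `x`.
  have J1 : ((r + 1) + x) * (L - 1) = x * (r + 1) := by
    have : s ^ 2 * x2 * (((r + 1) + x) * (L - 1) - x * (r + 1)) = 0 := by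
      rw [hs0r, hxx] at I1
      linear_combination I1 + (s * x2 * ((r + 1) + x)) * hLs
    have := (mul_eq_zero.1 this).resolve_left (by positivity)
    linarith
  have J2 : 2 * ((r + 1) + x) * (L - r) * x = (r + 1) ^ 2 := by
    have : s ^ 2 * x2 ^ 2 * (2 * ((r + 1) + x) * (L - r) * x - (r + 1) ^ 2) = 0 := by
      rw [hs0r, hxx] at I2
      linear_combination I2 + (2 * s * x2 ^ 2 * ((r + 1) + x) * x) * hLs
    have := (mul_eq_zero.1 this).resolve_left (by positivity)
    linarith
  have hroot : 4 * x ^ 2 + 2 * (1 - r) * (1 + r) * x - (1 + r) ^ 2 = 0 := by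
    linear_combination J2 - 2 * x * J1
  refine ⟨x, hxpos, ?_, ?_, ?_, hroot, ?_⟩
  · rw [hx1] at hy
    exact (div_pos_iff_of_pos_right hD).1 hy
  · rw [hx0, hx1, mul_div_assoc', div_left_inj' hD.ne'] at hxx
    exact hxx
  · rw [hx1] at hx2
    exact ((div_left_inj' hD.ne').1 hx2).symm
  · rw [← hL]
    have hne : 2 * x + 1 ≠ 0 := by positivity
    have : (2 * x * ((r + 1) + x)) * ((L - r) * (2 * x + 1) - 2) = 0 := by
      linear_combination (2 * x + 1) * J2 - hroot
    have := (mul_eq_zero.1 this).resolve_left (by positivity)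
    field_simp
    linarith

/-- Eliminating the linear term leaves `x - y` times a positive factor; equivalently, the product of
the two roots is negative. -/
theorem root_unique {r x y : ℝ} (hr : 0 < r) (hx : 0 < x) (hy : 0 < y)
    (h : 4 * x ^ 2 + 2 * (1 - r) * (1 + r) * x - (1 + r) ^ 2 = 0)
    (h' : 4 * y ^ 2 + 2 * (1 - r) * (1 + r) * y - (1 + r) ^ 2 = 0) : x = y := by
  have e : (x - y) * (4 * x * y + (1 + r) ^ 2) = 0 := by
    linear_combination y * h - x * h'
  have : 0 < 4 * x * y + (1 + r) ^ 2 := by positivity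
  linarith [(mul_eq_zero.1 e).resolve_right this.ne']

/-! ### Self-similar energy forms -/

section SelfSimilar

variable {E : C(gasket, ℝ) → ℝ≥0∞} {c s : Fin 3 → ℝ} {H : (Fin 3 → ℝ) → C(gasket, ℝ)}

theorem sum_ofReal_mul (hs : ∀ i, 0 < s i) {x : Fin 3 → ℝ} (hx : ∀ i, 0 ≤ x i) :
    ∑ i, ENNReal.ofReal (s i)⁻¹ * ENNReal.ofReal (x i) = ENNReal.ofReal (∑ i, (s i)⁻¹ * x i) := by
  rw [ENNReal.ofReal_sum_of_nonneg fun i _ => mul_nonneg (inv_nonneg.2 (hs i).le) (hx i)]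
  exact Finset.sum_congr rfl fun i _ => (ENNReal.ofReal_mul (inv_nonneg.2 (hs i).le)).symm

theorem sum_triangleForm_cellValues (c s m a : Fin 3 → ℝ) :
    ∑ i, (s i)⁻¹ * triangleForm c (cellValues m i a) - triangleForm c a =
      renormalizationGap (c 0) (c 1) (c 2) (s 0)⁻¹ (s 1)⁻¹ (s 2)⁻¹ (a 0) (a 1) (a 2)
        (m 1) (m 2) (m 0) := by
  simp only [Fin.sum_univ_three, triangleForm, cellValues, renormalizationGap, neg_zero, if_true,
    show (-1 : Fin 3) = 2 from rfl, show (-2 : Fin 3) = 1 from rfl,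
    show ((1 : Fin 3) = 0) = False from by decide, show ((2 : Fin 3) = 0) = False from by decide,
    show ((0 : Fin 3) = 1) = False from by decide, show ((0 : Fin 3) = 2) = False from by decide,
    show ((1 : Fin 3) = 2) = False from by decide, show ((2 : Fin 3) = 1) = False from by decide,
    if_false]

theorem IsTrace.compatible (hT : IsTrace E c H) (m a : Fin 3 → ℝ) :
    Compatible fun i => H (cellValues m i a) := by
  intro i j hij
  have h1 : i + j ≠ -i := by clear * - hij; revert i j; decide
  have h2 : i + j ≠ -j := by clear * - hij; revert i j; decide
  exact ((congrFun (hT.boundary _) _).trans (if_neg h1)).trans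
    ((congrFun (hT.boundary _) _).trans (if_neg h2)).symm

theorem IsTrace.triangleForm_le (hT : IsTrace E c H) (u : C(gasket, ℝ)) :
    ENNReal.ofReal (triangleForm c (boundaryValues u)) ≤ E u := by
  rw [hT.split u, hT.energy]
  exact le_self_add

/-- Gluing harmonic functions with junction values `m` gives a competitor with vertex values `a`,
and its energy is at least that of the trace. -/
theorem IsTrace.renormalization_le (hT : IsTrace E c H) (hs : ∀ i, 0 < s i)
    (hE : IsSelfSimilar s E) (a m : Fin 3 → ℝ) :
    triangleForm c a ≤ ∑ i, (s i)⁻¹ * triangleForm c (cellValues m i a) := by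
  have hb : boundaryValues (glue fun i => H (cellValues m i a)) = a := by
    ext i
    rw [boundaryValues, ← twistedF_corner_neg, glue_apply (hT.compatible m a)]
    refine (congrFun (hT.boundary (cellValues m i a)) (-i)).trans ?_
    rw [cellValues, if_pos rfl]
  have h1 := hT.triangleForm_le (glue fun i => H (cellValues m i a))
  rw [hb, hE] at h1
  simp only [glue_comp (hT.compatible m a), hT.energy] at h1
  rw [sum_ofReal_mul hs fun i => triangleForm_nonneg hT.nonneg _] at h1
  exact (ENNReal.ofReal_le_ofReal_iff (Finset.sum_nonneg fun i _ =>
    mul_nonneg (inv_nonneg.2 (hs i).le) (triangleForm_nonneg hT.nonneg _))).1 h1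

theorem exists_cellValues (u : C(gasket, ℝ)) :
    ∃ m, ∀ i, boundaryValues (u.comp (twistedF i)) = cellValues m i (boundaryValues u) := by
  -- Modulo 3, `1 - k ^ 2` selects one of the two cells at junction `k`: cell 1 for `k = 0` and cell
  -- 0 otherwise.
  refine ⟨fun k => u (twistedF (1 - k ^ 2) (corner k)), fun i => funext fun k => ?_⟩
  rw [cellValues]
  split_ifs with hk
  · rw [hk, boundaryValues_comp, twistedF_corner_neg]
    rfl
  · rw [boundaryValues_comp]
    by_cases hik : i = 1 - k ^ 2
    · rw [hik]
    · have h1 : k = i + (1 - k ^ 2) := by clear * - hk hik; revert i k; decide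
      have h2 := twistedF_corner_eq hik
      rw [← h1] at h2
      rw [h2]

/-- The junction values of `H a` itself attain the minimum, since in each cell its energy is at
least the trace of its corner values. -/
theorem IsTrace.exists_renormalization_eq (hT : IsTrace E c H) (hs : ∀ i, 0 < s i)
    (hE : IsSelfSimilar s E) (a : Fin 3 → ℝ) :
    ∃ m, ∑ i, (s i)⁻¹ * triangleForm c (cellValues m i a) = triangleForm c a := by
  obtain ⟨m, hm⟩ := exists_cellValues (H a)
  refine ⟨m, le_antisymm ?_ (hT.renormalization_le hs hE a m)⟩
  rw [← ENNReal.ofReal_le_ofReal_iff (triangleForm_nonneg hT.nonneg _), ← hT.energy a, hE,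
    ← sum_ofReal_mul hs fun i => triangleForm_nonneg hT.nonneg _]
  refine Finset.sum_le_sum fun i _ => mul_le_mul_right ?_ _
  have := hT.triangleForm_le ((H a).comp (twistedF i))
  rwa [hm, hT.boundary] at this

theorem IsTrace.eigenform (hT : IsTrace E c H) (hs : ∀ i, 0 < s i) (hE : IsSelfSimilar s E)
    (h12 : s 1 = s 2) :
    ∃ x, 0 < x ∧ 0 < c 1 ∧ c 0 = x * c 1 ∧ c 2 = c 1 ∧
      4 * x ^ 2 + 2 * (1 - s 0 / s 1) * (1 + s 0 / s 1) * x - (1 + s 0 / s 1) ^ 2 = 0 ∧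
      (s 1)⁻¹ = s 0 / s 1 + 2 / (2 * x + 1) := by
  refine eigenform_of_gap (hT.nonneg 0) (hT.nonneg 1) (hT.nonneg 2) hT.pos (hs 0) (hs 1)
    (fun a0 a1 a2 u v w => ?_) fun a0 a1 a2 => ?_
  · have h := sum_triangleForm_cellValues c s ![w, u, v] ![a0, a1, a2]
    have h1 := hT.renormalization_le hs hE ![a0, a1, a2] ![w, u, v]
    rw [← h12] at h
    exact (sub_nonneg.2 h1).trans_eq h
  · obtain ⟨m, hm⟩ := hT.exists_renormalization_eq hs hE ![a0, a1, a2]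
    have h := sum_triangleForm_cellValues c s m ![a0, a1, a2]
    rw [hm, sub_self, ← h12] at h
    exact ⟨_, _, _, h.symm⟩

theorem lt_one_of_eigenform {x : ℝ} (hs : ∀ i, 0 < s i) (h12 : s 1 = s 2) (hx : 0 < x)
    (hroot : 4 * x ^ 2 + 2 * (1 - s 0 / s 1) * (1 + s 0 / s 1) * x - (1 + s 0 / s 1) ^ 2 = 0)
    (hL : (s 1)⁻¹ = s 0 / s 1 + 2 / (2 * x + 1)) (i : Fin 3) : s i < 1 := by
  have h1 : s 1 < 1 := by
    have := one_lt_of_root (div_pos (hs 0) (hs 1)) hx hroot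
    rw [← hL] at this
    exact (one_lt_inv₀ (hs 1)).1 this
  have h0 : s 0 < 1 := by
    have h2 : 0 < 2 / (2 * x + 1) := by positivity
    have h3 : s 0 / s 1 < (s 1)⁻¹ := by linarith
    rwa [div_eq_mul_inv, mul_lt_iff_lt_one_left (inv_pos.2 (hs 1))] at h3
  have hi : i = 0 ∨ i = 1 ∨ i = 2 := by omega
  rcases hi with rfl | rfl | rfl
  · exact h0
  · exact h1
  · rwa [← h12]

theorem IsTrace.energy_interpolate (hT : IsTrace E c H) (hs : ∀ i, 0 < s i)
    (hE : IsSelfSimilar s E) (n : ℕ) (u : C(gasket, ℝ)) :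
    E (interpolate H n u) = ENNReal.ofReal (levelEnergy c s n u) := by
  induction n generalizing u with
  | zero => rw [interpolate, hT.energy, levelEnergy]
  | succ n ih =>
    rw [hE]
    simp only [interpolate_succ_comp hT.boundary, ih, levelEnergy]
    exact sum_ofReal_mul hs fun i => levelEnergy_nonneg hT.nonneg hs _ _

theorem IsTrace.split_interpolate (hT : IsTrace E c H) (hE : IsSelfSimilar s E) (n : ℕ)
    (u : C(gasket, ℝ)) : E u = E (interpolate H n u) + E (u - interpolate H n u) := by
  induction n generalizing u with
  | zero => exact hT.split u
  | succ n ih =>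
    rw [hE u, hE (interpolate _ _ _), hE (u - _), ← Finset.sum_add_distrib]
    refine Finset.sum_congr rfl fun i _ => ?_
    rw [show (u - interpolate H (n + 1) u).comp (twistedF i) = u.comp (twistedF i) -
      (interpolate H (n + 1) u).comp (twistedF i) from rfl, interpolate_succ_comp hT.boundary,
      ← mul_add, ← ih]

/-- The energy of level `n` reads only vertices at which the finer interpolant agrees with `u`. -/
theorem levelEnergy_interpolate_sub (hH : ∀ a, boundaryValues (H a) = a) (n k : ℕ)
    (u v : C(gasket, ℝ)) :
    levelEnergy c s n (interpolate H (n + k) u - v) = levelEnergy c s n (u - v) := by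
  induction n generalizing u v with
  | zero =>
    have h : boundaryValues (interpolate H (0 + k) u - v) = boundaryValues (u - v) :=
      congrArg (fun a => a - boundaryValues v) (boundaryValues_interpolate hH (0 + k) u)
    rw [levelEnergy, levelEnergy, h]
  | succ n ih =>
    simp only [levelEnergy]
    refine Finset.sum_congr rfl fun i _ => congrArg _ ?_
    rw [show (interpolate H (n + 1 + k) u - v).comp (twistedF i) =
      (interpolate H (n + 1 + k) u).comp (twistedF i) - v.comp (twistedF i) from rfl,
      show n + 1 + k = n + k + 1 by omega, interpolate_succ_comp hH, ih]
    rfl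

/-- A self-similar form is the limit of the energies that its trace induces on the approximating
graphs. -/
theorem IsTrace.eq_limitEnergy (hT : IsTrace E c H) (hN : IsNondegenerateEnergyForm E)
    (hE : IsSelfSimilar s E) (hc : ∀ i, 0 < c i) (hs : ∀ i, 0 < s i) (hs1 : ∀ i, s i < 1)
    (u : C(gasket, ℝ)) : E u = limitEnergy c s u := by
  have hP := hT.energy_interpolate hs hE
  have hle : ∀ n u, ENNReal.ofReal (levelEnergy c s n u) ≤ E u := fun n u => by
    rw [hT.split_interpolate hE n u, hP]
    exact le_self_add
  refine le_antisymm ?_ (iSup_le fun n => hle n u)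
  rcases eq_top_or_lt_top (limitEnergy c s u) with htop | hfin
  · rw [htop]
    exact le_top
  have hneg : ∀ w, E (-w) = E w := fun w => by
    have := hN.smul (-1) w
    rw [neg_one_smul] at this
    simpa using this
  have hle' : ∀ n, E (interpolate H n u) ≤ limitEnergy c s u := fun n => by
    rw [hP]
    exact le_iSup (fun n => ENNReal.ofReal (levelEnergy c s n u)) n
  -- By orthogonality the energies of the interpolants increase, and they are bounded by the finite
  -- limit energy, so the interpolants form a Cauchy sequence.
  have hadd : ∀ n k, E (interpolate H (n + k) u) = E (interpolate H n u) +
      E (interpolate H (n + k) u - interpolate H n u) := fun n k => by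
    have := hT.split_interpolate hE n (interpolate H (n + k) u)
    rwa [interpolate_interpolate hT.boundary] at this
  have hcau : ∀ ε : ℝ≥0∞, 0 < ε → ∃ N, ∀ m ≥ N, ∀ n ≥ N,
      E (interpolate H m u - interpolate H n u) < ε := by
    intro ε hε
    obtain ⟨N, hNε⟩ : ∃ N, limitEnergy c s u < E (interpolate H N u) + ε := by
      by_contra! hcon
      have h1 : limitEnergy c s u + ε ≤ limitEnergy c s u := by
        conv_lhs => rw [limitEnergy]
        rw [ENNReal.iSup_add]
        refine iSup_le fun n => ?_
        rw [← hP]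
        exact hcon n
      exact absurd h1 (not_le.2 (ENNReal.lt_add_right hfin.ne hε.ne'))
    have key : ∀ n ≥ N, ∀ k, E (interpolate H (n + k) u - interpolate H n u) < ε := by
      intro n hn k
      obtain ⟨l, rfl⟩ := Nat.exists_eq_add_of_le hn
      have h1 : E (interpolate H (N + l) u) +
          E (interpolate H (N + l + k) u - interpolate H (N + l) u) <
          E (interpolate H (N + l) u) + ε := by
        rw [← hadd]
        refine (hle' _).trans_lt (hNε.trans_le ?_)
        rw [hadd N l]
        exact add_le_add_left le_self_add _
      exact (ENNReal.add_lt_add_iff_left ((hle' _).trans_lt hfin).ne).1 h1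
    refine ⟨N, fun m hm n hn => ?_⟩
    rcases le_total n m with h | h
    · obtain ⟨k, rfl⟩ := Nat.exists_eq_add_of_le h
      exact key n hn k
    · obtain ⟨k, rfl⟩ := Nat.exists_eq_add_of_le h
      rw [← hneg, neg_sub]
      exact key m hm k
  -- It is not yet known that `u` has finite energy. Completeness gives a limit `v`; every graph
  -- energy of `u - v` vanishes, so `u` differs from `v` by a constant.
  obtain ⟨v, -, hv⟩ := hN.complete (fun n => interpolate H n u)
    (fun n => (hle' n).trans_lt hfin) hcau
  have hlev : ∀ k, levelEnergy c s k (u - v) = 0 := by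
    intro k
    have h1 : ENNReal.ofReal (levelEnergy c s k (u - v)) ≤ 0 := by
      refine ge_of_tendsto hv (Filter.eventually_atTop.2 ⟨k, fun n hn => ?_⟩)
      obtain ⟨l, rfl⟩ := Nat.exists_eq_add_of_le hn
      rw [← levelEnergy_interpolate_sub hT.boundary k l]
      exact hle k _
    rw [nonpos_iff_eq_zero, ENNReal.ofReal_eq_zero] at h1
    exact le_antisymm h1 (levelEnergy_nonneg hT.nonneg hs _ _)
  obtain ⟨K, -, hK⟩ := exists_abs_sub_corner_le hc hs hs1
  have hconst : ∀ x, u x - v x = u (corner 0) - v (corner 0) := fun x => by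
    have := hK (u - v) 0 le_rfl (fun n => by rw [hlev]; simp) x
    rw [mul_zero, abs_nonpos_iff, sub_eq_zero] at this
    exact this
  have hbound : ∀ n, E u ≤ limitEnergy c s u + E (interpolate H n u - v) := fun n => by
    rw [hT.split_interpolate hE n u]
    refine add_le_add (hle' n) ?_
    rw [← hneg (interpolate H n u - v), neg_sub]
    refine (hT.add_const _ _ (u (corner 0) - v (corner 0)) fun x => ?_).le
    rw [ContinuousMap.sub_apply, ContinuousMap.sub_apply]
    linarith [hconst x]
  have hlim : Filter.Tendsto (fun n => limitEnergy c s u + E (interpolate H n u - v)) Filter.atTop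
      (𝓝 (limitEnergy c s u)) := by
    simpa using hv.const_add (limitEnergy c s u)
  exact ge_of_tendsto' hlim hbound

theorem limitEnergy_smul_conductance {k : ℝ} (hk : 0 ≤ k) (u : C(gasket, ℝ)) :
    limitEnergy (fun i => k * c i) s u = ENNReal.ofReal k * limitEnergy c s u := by
  simp only [limitEnergy, levelEnergy_congr_weights, ENNReal.ofReal_mul hk, ENNReal.mul_iSup]

/-- Composition with `gasketR` puts a copy of `u` on every cell. -/
theorem isRInvariant_of_isSelfSimilar (hs : ∀ i, 0 < s i) (hE : IsSelfSimilar s E) :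
    IsRInvariant (∑ i, (s i)⁻¹) E := by
  intro u
  have h : ∀ i, (u.comp gasketR).comp (twistedF i) = u := fun i =>
    ContinuousMap.ext fun x => congrArg u (gasketR_twistedF i x)
  rw [hE]
  simp only [h]
  rw [← Finset.sum_mul, ENNReal.ofReal_sum_of_nonneg fun i _ => (inv_nonneg.2 (hs i).le)]

/-- Reflection symmetry forces the weights of the two reflected cells to agree. -/
theorem weights_eq_of_isConjSymmetric (hN : IsNondegenerateEnergyForm E) (hs : ∀ i, 0 < s i)
    (hE : IsSelfSimilar s E) (hC : IsConjSymmetric E) : s 1 = s 2 := by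
  obtain ⟨c, H, hT⟩ := exists_trace hN
  -- Corner 2 of cell 1 is vertex 1, so these data vanish at the junctions and glue to a function
  -- supported in cell 1. Reflection moves it to cell 2 without changing the energy of the piece,
  -- and the two weights can be compared.
  let g : Fin 3 → C(gasket, ℝ) := ![0, H (Pi.single 2 1), 0]
  have hb : ∀ k : Fin 3, H (Pi.single 2 1) (corner k) = (Pi.single 2 1 : Fin 3 → ℝ) k := fun k =>
    congrFun (hT.boundary _) k
  have hg : Compatible g := by
    intro i j hij
    have hi : i = 0 ∨ i = 1 ∨ i = 2 := by omega
    have hj : j = 0 ∨ j = 1 ∨ j = 2 := by omega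
    rcases hi with rfl | rfl | rfl <;> rcases hj with rfl | rfl | rfl <;>
      simp [g, hb, show (1 : Fin 3) + 2 = 0 from rfl, show (2 : Fin 3) + 1 = 0 from rfl] at hij ⊢
  have h0 : E 0 = 0 := (hN.eq_zero_iff 0).2 ⟨0, fun _ => rfl⟩
  have hpos : E (H (Pi.single 2 1)) ≠ 0 := by
    intro h
    obtain ⟨t, ht⟩ := (hN.eq_zero_iff _).1 h
    have h2 := hb 2
    have h1 := hb 1
    rw [ht, Pi.single_eq_same] at h2
    rw [ht, Pi.single_eq_of_ne (by decide)] at h1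
    linarith
  have hfin : E (H (Pi.single 2 1)) ≠ ∞ := by
    rw [hT.energy]
    exact ENNReal.ofReal_ne_top
  have hcomp : ∀ i, ((glue g).comp gasketConj).comp (twistedF i) = (g (-i)).comp gasketConj := by
    intro i
    rw [← glue_comp hg]
    exact ContinuousMap.ext fun x => congrArg (glue g) (gasketConj_twistedF i x)
  have key := hC (glue g)
  rw [hE, hE (glue g)] at key
  simp only [hcomp, hC (g _), glue_comp hg, Fin.sum_univ_three, neg_zero,
    show (-1 : Fin 3) = 2 from rfl, show (-2 : Fin 3) = 1 from rfl] at key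
  simp only [g, Matrix.cons_val_zero, Matrix.cons_val_one, Matrix.cons_val, h0, mul_zero, zero_add,
    add_zero] at key
  rw [ENNReal.mul_left_inj hpos hfin, ENNReal.ofReal_eq_ofReal_iff (inv_nonneg.2 (hs 2).le)
    (inv_nonneg.2 (hs 1).le)] at key
  exact (inv_injective key).symm

/-- A self-similar form with `s 1 = s 2` is unique up to a multiple, symmetric, and has weights
less than one. -/
theorem isSelfSimilar_unique (hN : IsNondegenerateEnergyForm E) (hs : ∀ i, 0 < s i)
    (h12 : s 1 = s 2) (hE : IsSelfSimilar s E) :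
    (∀ E' : C(gasket, ℝ) → ℝ≥0∞, IsNondegenerateEnergyForm E' →
      (IsSelfSimilar s E' ↔ ∃ k : ℝ, 0 < k ∧ ∀ u, E' u = ENNReal.ofReal k * E u)) ∧
    (∀ i, s i < 1) ∧ IsConjSymmetric E := by
  obtain ⟨c, H, hT⟩ := exists_trace hN
  obtain ⟨x, hx, hc1, hc0, hc2, hroot, hL⟩ := hT.eigenform hs hE h12
  have hs1 := lt_one_of_eigenform hs h12 hx hroot hL
  have hcpos : ∀ {c : Fin 3 → ℝ} {x : ℝ}, 0 < x → 0 < c 1 → c 0 = x * c 1 → c 2 = c 1 →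
      ∀ i, 0 < c i := by
    intro c x hx h1 h0 h2 i
    have hi : i = 0 ∨ i = 1 ∨ i = 2 := by omega
    rcases hi with rfl | rfl | rfl
    · rw [h0]
      positivity
    · exact h1
    · rwa [h2]
  have hlim := hT.eq_limitEnergy hN hE (hcpos hx hc1 hc0 hc2) hs hs1
  refine ⟨fun E' hN' => ⟨fun hE' => ?_, ?_⟩, hs1, fun u => ?_⟩
  · obtain ⟨c', H', hT'⟩ := exists_trace hN'
    obtain ⟨x', hx', hc1', hc0', hc2', hroot', -⟩ := hT'.eigenform hs hE' h12
    have hxx : x' = x := root_unique (div_pos (hs 0) (hs 1)) hx' hx hroot' hroot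
    have hlim' := hT'.eq_limitEnergy hN' hE' (hcpos hx' hc1' hc0' hc2') hs hs1
    have hk : 0 < c' 1 / c 1 := div_pos hc1' hc1
    refine ⟨c' 1 / c 1, hk, fun u => ?_⟩
    rw [hlim, hlim', ← limitEnergy_smul_conductance hk.le]
    congr 1
    ext i
    have hne := hc1.ne'
    have hi : i = 0 ∨ i = 1 ∨ i = 2 := by omega
    rcases hi with rfl | rfl | rfl
    · rw [hc0, hc0', hxx]
      field_simp
    · field_simp
    · rw [hc2, hc2']
      field_simp
  · rintro ⟨k, -, hk⟩ u
    simp only [hk]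
    rw [hE u, Finset.mul_sum]
    exact Finset.sum_congr rfl fun i _ => mul_left_comm _ _ _
  · simp only [hlim, limitEnergy, levelEnergy_comp_conj hc2.symm h12]

end SelfSimilar

/-- There is exactly one normalization of the weights that admits a self-similar form. -/
theorem existsUnique_normalization {r : Fin 3 → ℝ} (hr : ∀ i, 0 < r i) (h12 : r 1 = r 2) :
    ∃! lam : ℝ, 0 < lam ∧ ∃ E : C(gasket, ℝ) → ℝ≥0∞,
      IsNondegenerateEnergyForm E ∧ IsSelfSimilar (fun i => lam⁻¹ * r i) E := by
  have hr0 : 0 < r 0 / r 1 := div_pos (hr 0) (hr 1)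
  have hne := (hr 1).ne'
  obtain ⟨x, hx, hroot⟩ := exists_root hr0
  have hL : 0 < r 0 / r 1 + 2 / (2 * x + 1) := by positivity
  -- The eigenvalue relation prescribes `(lam⁻¹ * r 1)⁻¹`, which leaves this single choice.
  refine ⟨r 1 * (r 0 / r 1 + 2 / (2 * x + 1)), ⟨mul_pos (hr 1) hL, ?_⟩, ?_⟩
  · have h1 : (r 1 * (r 0 / r 1 + 2 / (2 * x + 1)))⁻¹ * r 1 =
        (r 0 / r 1 + 2 / (2 * x + 1))⁻¹ := by
      rw [mul_inv, mul_right_comm, inv_mul_cancel₀ hne, one_mul]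
    refine exists_form hr0 hx hroot ?_ h1 ?_
    · rw [mul_inv, div_eq_mul_inv]
      ring
    · rw [← h12]
      exact h1
  · rintro lam ⟨hlam, E, hN, hE⟩
    have hs : ∀ i, 0 < lam⁻¹ * r i := fun i => mul_pos (inv_pos.2 hlam) (hr i)
    obtain ⟨c, H, hT⟩ := exists_trace hN
    obtain ⟨y, hy, -, -, -, hroot', hL'⟩ := hT.eigenform hs hE (by simp only [h12])
    have hdiv : lam⁻¹ * r 0 / (lam⁻¹ * r 1) = r 0 / r 1 :=
      mul_div_mul_left _ _ (inv_ne_zero hlam.ne')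
    rw [hdiv] at hroot' hL'
    rw [root_unique hr0 hy hx hroot' hroot, mul_inv, inv_inv] at hL'
    rw [← hL']
    field_simp

/-! ### The rational map -/

/-- As ω⁻¹ = ω², both terms of the rational map acquire the factor ω². The finite value `w` excludes
the pole at 0. -/
theorem rationalR_omega_mul {z w : ℂ} (h : rationalR (z : OnePoint ℂ) = (w : OnePoint ℂ)) :
    rationalR ((omega * z : ℂ) : OnePoint ℂ) = ((omega ^ 2 * w : ℂ) : OnePoint ℂ) := by
  have h3 := omega_pow_three
  have ho : omega ≠ 0 := fun h => by simp [h] at h3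
  have hz : z ≠ 0 := by
    rintro rfl
    simp [rationalR] at h
  have hzo : omega * z ≠ 0 := mul_ne_zero ho hz
  have h1 : ∀ z : ℂ, z ≠ 0 → rationalR (z : OnePoint ℂ) = ((z ^ 2 - 16 / (27 * z) : ℂ) : OnePoint ℂ) :=
    fun z hz => by simp [rationalR, hz]
  rw [h1 z hz, OnePoint.coe_eq_coe] at h
  rw [h1 _ hzo, OnePoint.coe_eq_coe, ← h]
  field_simp
  linear_combination 16 * h3

/-- F̃₁ = ω ∘ F₀ ∘ ω and F̃₂ = ω² ∘ F₀ ∘ ω², so equivariance leaves the total factor ω³ or ω⁶, which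
is 1. -/
theorem IsJuliaIdentification.rationalR_twistedF {h : gasket → ℂ} (hh : IsJuliaIdentification h)
    (i : Fin 3) (x : gasket) : rationalR (h (twistedF i x)) = h x := by
  have h3 := omega_pow_three
  have h1 : twistedF 1 x = gasketRot (gasketF 0 (gasketRot x)) := by
    apply Subtype.ext
    change contraction 1 (omega * (omega * x)) = omega * contraction 0 (omega * x)
    simp only [contraction, vertex, Fin.val_zero, Fin.val_one, pow_zero, pow_one]
    ring
  have h2 : twistedF 2 x = gasketRot (gasketRot (gasketF 0 (gasketRot (gasketRot x)))) := by
    apply Subtype.ext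
    change contraction 2 (omega * x) = omega * (omega * contraction 0 (omega * (omega * x)))
    simp only [contraction, vertex, Fin.val_zero, Fin.val_two, pow_zero]
    linear_combination (-(1 / 2) * omega * x) * h3
  have hi : i = 0 ∨ i = 1 ∨ i = 2 := by omega
  rcases hi with rfl | rfl | rfl
  · exact hh.branch x
  · rw [h1, hh.rot, rationalR_omega_mul (hh.branch _), hh.rot, OnePoint.coe_eq_coe]
    linear_combination h x * h3
  · rw [h2, hh.rot, hh.rot, rationalR_omega_mul (rationalR_omega_mul (hh.branch _)), hh.rot,
      hh.rot, OnePoint.coe_eq_coe]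
    linear_combination h x * (omega ^ 3 + 1) * h3

theorem theorem1 :
    -- the twisted IFS consists of the inverse branches of `R(z) = z² - 16/(27z)`
    (∀ h : gasket → ℂ, IsJuliaIdentification h →
      (∀ (i : Fin 3) (x : gasket), rationalR (h (twistedF i x)) = h x) ∧
      ∀ x : gasket, rationalR (h x) = h (gasketR x)) ∧
    (∀ r : Fin 3 → ℝ, (∀ i, 0 < r i) → r 1 = r 2 →
      -- there is exactly one `lam > 0` for which a form exists
      (∃! lam : ℝ, 0 < lam ∧ ∃ E : C(gasket, ℝ) → ℝ≥0∞,
        IsNondegenerateEnergyForm E ∧ IsSelfSimilar (fun i => lam⁻¹ * r i) E) ∧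
      -- for this `lam`, the form is unique up to a constant multiple, the weights are less
      -- than one, and the form is symmetric and `R`-invariant
      ∀ lam : ℝ, 0 < lam → ∀ E : C(gasket, ℝ) → ℝ≥0∞,
        IsNondegenerateEnergyForm E → IsSelfSimilar (fun i => lam⁻¹ * r i) E →
        (∀ E' : C(gasket, ℝ) → ℝ≥0∞, IsNondegenerateEnergyForm E' →
          (IsSelfSimilar (fun i => lam⁻¹ * r i) E' ↔
            ∃ c : ℝ, 0 < c ∧ ∀ u, E' u = ENNReal.ofReal c * E u)) ∧
        (∀ i, 0 < lam⁻¹ * r i ∧ lam⁻¹ * r i < 1) ∧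
        IsConjSymmetric E ∧
        IsRInvariant (∑ i, (lam⁻¹ * r i)⁻¹) E) ∧
    -- every symmetric and `R`-invariant self-similar form arises in this way
    (∀ E : C(gasket, ℝ) → ℝ≥0∞, IsNondegenerateEnergyForm E →
      ((∃ s : Fin 3 → ℝ, (∀ i, 0 < s i) ∧ IsSelfSimilar s E ∧
          IsConjSymmetric E ∧ IsRInvariant (∑ i, (s i)⁻¹) E) ↔
        ∃ r : Fin 3 → ℝ, (∀ i, 0 < r i) ∧ r 1 = r 2 ∧
          ∃ lam : ℝ, 0 < lam ∧ IsSelfSimilar (fun i => lam⁻¹ * r i) E)) := by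
  refine ⟨fun h hh => ⟨hh.rationalR_twistedF, fun x => ?_⟩, fun r hr h12 =>
    ⟨existsUnique_normalization hr h12, fun lam hlam E hN hE => ?_⟩, fun E hN => ⟨?_, ?_⟩⟩
  · obtain ⟨i, y, rfl⟩ := exists_twistedF x
    rw [hh.rationalR_twistedF, gasketR_twistedF]
  · have hs : ∀ i, 0 < lam⁻¹ * r i := fun i => mul_pos (inv_pos.2 hlam) (hr i)
    obtain ⟨h1, h2, h3⟩ := isSelfSimilar_unique hN hs (by simp only [h12]) hE
    exact ⟨h1, fun i => ⟨hs i, h2 i⟩, h3, isRInvariant_of_isSelfSimilar hs hE⟩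
  · rintro ⟨s, hs, hE, hC, -⟩
    -- The weights `s` are already normalized, so they serve as `r` with `lam = 1`.
    exact ⟨s, hs, weights_eq_of_isConjSymmetric hN hs hE hC, 1, one_pos, by simpa using hE⟩
  · rintro ⟨r, hr, h12, lam, hlam, hE⟩
    have hs : ∀ i, 0 < lam⁻¹ * r i := fun i => mul_pos (inv_pos.2 hlam) (hr i)
    exact ⟨_, hs, hE, (isSelfSimilar_unique hN hs (by simp only [h12]) hE).2.2,
      isRInvariant_of_isSelfSimilar hs hE⟩
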